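/- Fix an integer $p\ge 1$. Consider the following maximization problems over a stream, whose elements form a ground set $E$ and arrive one by one in arbitrary order, each exactly once per pass, in the same order in each pass. Constraints. (H) $E$ is the edge set of a $p$-hypergraph on the known vertex set $[n]$ (each edge is a set of at most $p$ vertices), and the independent sets are the hypermatchings, i.e. the sets of pairwise disjoint edges. (M) $p$ matroids on the same ground set $E$, $m=|E|$, are given by oracles that, on input $S\subseteq E$, return $\emptyset$ if $S$ is independent in the matroid and otherwise a circuit contained in $S$; the independent sets are the sets independent in all $p$ matroids, and $n$ denotes the maximal size of such a set. (PM) is the case of (M) in which each of the $p$ matroids is a partition matroid: its independent sets are $\{I\subseteq E: |I\cap E^j|\le k^j \text{ for all } j\}$ for a partition $E^1,\dots,E^r$ of $E$ and positive integers $k^1,\dots,k^r$. Objectives. In MWIS each element arrives with a non-negative weight, and the goal is an independent set of maximum total weight. In $f$-MSIS, $f:2^E\to\mathbb R_+$ is a monotone submodular function with $f(\emptyset)=0$, given by a value oracle that may be queried only on sets of currently stored elements, and the goal is an independent set $I$ maximizing $f(I)$. An output $I$ is $\alpha$-approximate if $I$ is independent and the objective value of each independent set is at most $\alpha$ times that of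 $I$. Space is counted in bits; a stored real (a weight or a value of $f$) is counted as $O(1)$. There is an absolute constant $K$, and for each $p\ge1$ there is a constant $C$ depending only on $p$, such that there are deterministic streaming algorithms that use at most $C(n+1)\log(n+2)$ bits for (H), and at most $C(n+1)\log (m+2)$ bits for (M) and (PM), and achieve the following. (1) One pass, for (H) and for (M): a $\bigl(2(p+\sqrt{p(p-1)})-1\bigr)$-approximation for MWIS, and a $4p$-approximation for $f$-MSIS for every such $f$. (2) For every $\varepsilon>0$, in at most $1+K\,p^4\,\varepsilon^{-3}\log(p+1)$ passes (thus $O(\varepsilon^{-3}\log p)$ passes, where $p$ is regarded as a constant), for (H) and for (PM): a $(p+\varepsilon)$-approximation for MWIS, and a $(p+1+\varepsilon)$-approximation for $f$-MSIS for every such $f$. -/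

import Mathlib

open Finset

/-! ## Submodular functions and approximate solutions -/

/-- A non-negative, monotone, proper, submodular function on the subsets of the ground set `E`. -/
structure IsSubmodularOn {α : Type} [DecidableEq α] (E : Finset α) (f : Finset α → ℝ) :
    Prop where
  proper : f ∅ = 0
  nonneg : ∀ A ⊆ E, 0 ≤ f A
  mono : ∀ A B : Finset α, A ⊆ B → B ⊆ E → f A ≤ f B
  submodular : ∀ A ⊆ E, ∀ B ⊆ E, f (A ∪ B) + f (A ∩ B) ≤ f A + f B

/-- `I` is a `ρ`-approximate maximizer of `f` over the subsets of `E` that satisfy `ind`. -/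
def IsApproxMax {α : Type} (E : Finset α) (ind : Finset α → Prop) (f : Finset α → ℝ) (ρ : ℝ)
    (I : Finset α) : Prop :=
  I ⊆ E ∧ ind I ∧ ∀ J ⊆ E, ind J → f J ≤ ρ * f I

/-! ## Streaming algorithms

The working memory is a list of cells. A cell holds a stream element, a real number that was
received from outside (the weight of an element, or an answer of the value oracle), or a natural
number. The algorithm may freely read its memory and decide what to do next, but it cannot make up
elements or reals: such cells only arise from the stream, from the oracles, or by copying.
In particular every set that is sent to an oracle consists of elements of the stream that are
currently stored. -/

inductive Cell (α : Type) where
  | elem (a : α)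
  | val (r : ℝ)
  | num (k : ℕ)

/-- A cell of the new memory in a rewriting instruction. -/
inductive Ref where
  /-- a copy of the cell at position `i` of the old memory -/
  | copy (i : ℕ)
  /-- a new cell holding the natural number `k` -/
  | num (k : ℕ)

/-- Instructions of an algorithm with access to `q` independence oracles. -/
inductive Instr (q : ℕ) where
  /-- replace the memory -/
  | rewrite (l : List Ref)
  /-- ask the value oracle for `f S`, where `S` is the set of elements stored at the positions
  in `l` -/
  | value (l : List ℕ)
  /-- send the set of elements stored at the positions in `l` to the `i`-th independence oracle -/
  | circuit (i : Fin q) (l : List ℕ)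
  /-- wait for the next stream item -/
  | next

/-- A streaming algorithm: its next instruction is a function of the memory contents. -/
abbrev Algo (α : Type) (q : ℕ) : Type := List (Cell α) → Instr q

/-- The entities outside the algorithm that answer its queries. -/
structure Oracles (α : Type) (q : ℕ) where
  value : Finset α → ℝ
  circuit : Fin q → Finset α → Finset α

def Cell.elem? {α : Type} : Cell α → Option α
  | .elem a => some a
  | _ => none

/-- The set of the elements that are stored in the memory. -/
def stored {α : Type} [DecidableEq α] (mem : List (Cell α)) : Finset α :=
  (mem.filterMap Cell.elem?).toFinset

/-- The set of the elements stored at the positions in `l`. -/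
def elemsAt {α : Type} [DecidableEq α] (mem : List (Cell α)) (l : List ℕ) : Finset α :=
  stored (l.filterMap fun i => mem[i]?)

def Ref.eval {α : Type} (mem : List (Cell α)) : Ref → Option (Cell α)
  | .copy i => mem[i]?
  | .num k => some (.num k)

/-- The memory after an instruction. Answers of oracles are put in front of the old memory; the
answer of an independence oracle is a set of elements, preceded by its size. -/
noncomputable def execInstr {α : Type} [DecidableEq α] {q : ℕ} (O : Oracles α q)
    (mem : List (Cell α)) : Instr q → List (Cell α)
  | .rewrite l => l.filterMap (Ref.eval mem)
  | .value l => .val (O.value (elemsAt mem l)) :: mem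
  | .circuit i l =>
      .num (#(O.circuit i (elemsAt mem l))) ::
        ((O.circuit i (elemsAt mem l)).toList.map Cell.elem ++ mem)
  | .next => mem

/-- Number of bits taken up by a cell, where the name of the element `a` takes `cost a` bits. A real
received from outside takes unit storage. -/
def Cell.bits {α : Type} (cost : α → ℕ) : Cell α → ℕ
  | .elem a => cost a
  | .val _ => 1
  | .num k => Nat.size k + 1

/-- Number of bits taken up by the memory. -/
def memBits {α : Type} (cost : α → ℕ) (mem : List (Cell α)) : ℕ :=
  (mem.map (Cell.bits cost)).sum

/-- `Handles A O cost s mem mem'`: started with memory `mem`, the algorithm executes finitely many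
instructions until it asks for the next stream item, it then has memory `mem'`, and at no time the
memory takes up more than `s` bits. -/
inductive Handles {α : Type} [DecidableEq α] {q : ℕ} (A : Algo α q) (O : Oracles α q)
    (cost : α → ℕ) (s : ℕ) : List (Cell α) → List (Cell α) → Prop where
  | done (mem : List (Cell α)) : A mem = .next → memBits cost mem ≤ s →
      Handles A O cost s mem mem
  | step (mem mem' : List (Cell α)) : A mem ≠ .next → memBits cost mem ≤ s →
      Handles A O cost s (execInstr O mem (A mem)) mem' → Handles A O cost s mem mem'

/-- `Reads A O cost s items mem mem'`: started with memory `mem`, the algorithm reads the stream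
items one after the other, ending up with memory `mem'` and never using more than `s` bits. An item
is a list of cells, which is put in front of the memory when the item arrives. -/
inductive Reads {α : Type} [DecidableEq α] {q : ℕ} (A : Algo α q) (O : Oracles α q)
    (cost : α → ℕ) (s : ℕ) :
    List (List (Cell α)) → List (Cell α) → List (Cell α) → Prop where
  | nil (mem : List (Cell α)) : Reads A O cost s [] mem mem
  | cons (item : List (Cell α)) (items : List (List (Cell α))) (mem mem₁ mem₂ : List (Cell α)) :
      Handles A O cost s (item ++ mem) mem₁ → Reads A O cost s items mem₁ mem₂ →
      Reads A O cost s (item :: items) mem mem₂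

/-- One pass over the stream `σ`: the elements in the given order, then a mark for the end of the
pass. -/
def plainPass {α : Type} (σ : List α) : List (List (Cell α)) :=
  σ.map (fun e => [Cell.elem e]) ++ [[Cell.num 0]]

/-- The same, where each element arrives together with its weight. -/
def weightedPass {α : Type} (w : α → ℝ) (σ : List α) : List (List (Cell α)) :=
  σ.map (fun e => [Cell.elem e, Cell.val (w e)]) ++ [[Cell.num 0]]

/-- Starting with empty memory, the algorithm makes `k` passes, using at most `s` bits of memory at
all times, and in the end the set of elements in its memory is `I`. -/
def Outputs {α : Type} [DecidableEq α] {q : ℕ} (A : Algo α q) (O : Oracles α q)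
    (cost : α → ℕ) (s k : ℕ) (pass : List (List (Cell α))) (I : Finset α) : Prop :=
  ∃ mem, Reads A O cost s (List.replicate k pass).flatten [] mem ∧ stored mem = I

/-- The `k`-pass algorithm `A` computes, in `s` bits of memory, a `ρ`-approximate maximum weight
independent set of the elements of the stream `σ`, each arriving together with its weight.
There is no value oracle: it always answers `0`. -/
def SolvesMWIS {α : Type} [DecidableEq α] {q : ℕ} (A : Algo α q)
    (circuit : Fin q → Finset α → Finset α) (cost : α → ℕ) (s k : ℕ) (ρ : ℝ)
    (ind : Finset α → Prop) (σ : List α) (w : α → ℝ) : Prop :=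
  ∃ I, Outputs A ⟨fun _ => 0, circuit⟩ cost s k (weightedPass w σ) I ∧
    IsApproxMax σ.toFinset ind (fun S => ∑ e ∈ S, w e) ρ I

/-- The `k`-pass algorithm `A` computes, in `s` bits of memory, a `ρ`-approximate `f`-maximal
independent set of the elements of the stream `σ`, with a value oracle for `f`. -/
def SolvesMSIS {α : Type} [DecidableEq α] {q : ℕ} (A : Algo α q)
    (circuit : Fin q → Finset α → Finset α) (cost : α → ℕ) (s k : ℕ) (ρ : ℝ)
    (ind : Finset α → Prop) (σ : List α) (f : Finset α → ℝ) : Prop :=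
  ∃ I, Outputs A ⟨f, circuit⟩ cost s k (plainPass σ) I ∧ IsApproxMax σ.toFinset ind f ρ I

/-! ## Matchings in hypergraphs -/

/-- A set of hyperedges is a matching if its members are pairwise disjoint. -/
def IsHypermatching {V : Type} (M : Finset (Finset V)) : Prop :=
  (M : Set (Finset V)).Pairwise Disjoint

/-- A stream of distinct hyperedges of size at most `p`. -/
def IsHyperedgeStream {V : Type} (p : ℕ) (σ : List (Finset V)) : Prop :=
  σ.Nodup ∧ ∀ e ∈ σ, #e ≤ p

/-- A hyperedge on `n` vertices is stored as the list of its vertices. -/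
def hyperedgeCost (n : ℕ) (e : Finset (Fin n)) : ℕ := #e * Nat.size n + 1

/-- In `k` passes and `O(n log n)` bits, with constant `C`, the algorithms `A n` compute
`ρ`-approximate maximum weight matchings in all `p`-hypergraphs on `n` vertices, for all `n`. -/
def HypergraphMWIS (p k C : ℕ) (ρ : ℝ) (A : (n : ℕ) → Algo (Finset (Fin n)) 0) : Prop :=
  ∀ (n : ℕ) (σ : List (Finset (Fin n))), IsHyperedgeStream p σ →
    ∀ w : Finset (Fin n) → ℝ, (∀ e ∈ σ, 0 ≤ w e) →
      SolvesMWIS (A n) (fun _ _ => ∅) (hyperedgeCost n) (C * (n + 1) * Nat.size (n + 1)) k ρ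
        IsHypermatching σ w

/-- The same for `ρ`-approximate maximum `f`-matchings, for all submodular `f`. -/
def HypergraphMSIS (p k C : ℕ) (ρ : ℝ) (A : (n : ℕ) → Algo (Finset (Fin n)) 0) : Prop :=
  ∀ (n : ℕ) (σ : List (Finset (Fin n))), IsHyperedgeStream p σ →
    ∀ f : Finset (Finset (Fin n)) → ℝ, IsSubmodularOn σ.toFinset f →
      SolvesMSIS (A n) (fun _ _ => ∅) (hyperedgeCost n) (C * (n + 1) * Nat.size (n + 1)) k ρ
        IsHypermatching σ f

/-! ## Intersections of matroids -/

/-- A set is independent in all of the matroids. -/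
def CommonIndep {m p : ℕ} (M : Fin p → Matroid (Fin m)) (I : Finset (Fin m)) : Prop :=
  ∀ i, (M i).Indep (I : Set (Fin m))

/-- The largest size of a common independent set. -/
noncomputable def commonRank {m p : ℕ} (M : Fin p → Matroid (Fin m)) : ℕ :=
  sSup {r | ∃ I, CommonIndep M I ∧ #I = r}

/-- An oracle for the matroid `M`: it answers a query `S` by the empty set if `S` is independent,
and otherwise by a circuit in `S`. -/
def IsCircuitOracle {m : ℕ} (M : Matroid (Fin m)) (orc : Finset (Fin m) → Finset (Fin m)) :
    Prop :=
  ∀ S : Finset (Fin m),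
    (M.Indep (S : Set (Fin m)) → orc S = ∅) ∧
    (¬ M.Indep (S : Set (Fin m)) → orc S ⊆ S ∧ M.IsCircuit (orc S : Set (Fin m)))

/-- `M` is the matroid of all sets with at most `b j > 0` elements in the `j`-th class of some
partition of the ground set. -/
def IsPartitionMatroid {m : ℕ} (M : Matroid (Fin m)) : Prop :=
  ∃ (r : ℕ) (cls : Fin m → Fin r) (b : Fin r → ℕ), (∀ j, 0 < b j) ∧
    ∀ I : Finset (Fin m), M.Indep (I : Set (Fin m)) ↔ ∀ j, #{e ∈ I | cls e = j} ≤ b j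

/-- For all families of `p` matroids `M i` on a common ground set of `m` elements such that all
`M i` satisfy `P`, given by circuit oracles, the algorithms `A m` compute `ρ`-approximate maximum
weight common independent sets, in `k` passes and `O(n log m)` bits with constant `C`, where `n` is
the maximal size of a common independent set. -/
def MatroidMWIS (P : ∀ m : ℕ, Matroid (Fin m) → Prop) (p k C : ℕ) (ρ : ℝ)
    (A : (m : ℕ) → Algo (Fin m) p) : Prop :=
  ∀ (m : ℕ) (M : Fin p → Matroid (Fin m)), (∀ i, (M i).E = Set.univ) → (∀ i, P m (M i)) →
    ∀ orc : Fin p → Finset (Fin m) → Finset (Fin m), (∀ i, IsCircuitOracle (M i) (orc i)) →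
    ∀ σ : List (Fin m), σ.Nodup → (∀ e, e ∈ σ) →
    ∀ w : Fin m → ℝ, (∀ e, 0 ≤ w e) →
      SolvesMWIS (A m) orc (fun _ => Nat.size m) (C * (commonRank M + 1) * Nat.size (m + 1)) k ρ
        (CommonIndep M) σ w

/-- The same for `ρ`-approximate maximum `f`-independent sets, for all submodular `f`. -/
def MatroidMSIS (P : ∀ m : ℕ, Matroid (Fin m) → Prop) (p k C : ℕ) (ρ : ℝ)
    (A : (m : ℕ) → Algo (Fin m) p) : Prop :=
  ∀ (m : ℕ) (M : Fin p → Matroid (Fin m)), (∀ i, (M i).E = Set.univ) → (∀ i, P m (M i)) →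
    ∀ orc : Fin p → Finset (Fin m) → Finset (Fin m), (∀ i, IsCircuitOracle (M i) (orc i)) →
    ∀ σ : List (Fin m), σ.Nodup → (∀ e, e ∈ σ) →
    ∀ f : Finset (Fin m) → ℝ, IsSubmodularOn Finset.univ f →
      SolvesMSIS (A m) orc (fun _ => Nat.size m) (C * (commonRank M + 1) * Nat.size (m + 1)) k ρ
        (CommonIndep M) σ f

/-! The algorithms are one-swap local search. The solution is a list, newest element first, and an
element weighs its marginal value over the older ones. An arriving `e` replaces a conflict set `C`
when its marginal value is at least `r` times the weight of `C`.

Let `κ` be the total weight removed during a pass. Each exchange gains at least `r - 1` times the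
removed weight, so `(r - 1) * κ` is at most the increase of `f`. Conversely, an optimal `J` is
charged to the solution and the removed elements. In each constraint a rejected `o` is spanned by
elements at least as heavy as the conflict element it lost to. An exchange keeps this true
(`accept_step`): where `x` was chosen as conflict element, `e` and the rest of the circuit, all at
least as heavy, span it; in the at most `p - 1` other constraints `x` is remembered as dead. Since
`J` is independent, it has at every weight level no more charges than there are live and dead
elements. Summing over levels and constraints (`sum_marginal_le`), the marginals of `J` total at
most `r * (p * f L + (p - 1) * κ)`. For submodular `f`, a further `f L + κ` pays for the set of all
elements ever held.

After one pass `κ` is at most `f L / (r - 1)` if `r > 1`, and a suitable `r` gives the one-pass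
ratios. With `r` near `1` and many passes, the gap to the optimum shrinks geometrically
(`le_mul_of_progress`).

Hypermatchings and matroid intersections enter only through a `ClosureSystem` and a rule for
conflict sets (`hyperSystem_isRule`, `matroidSystem_isRule`). `searchAlgo` runs the search on the
memory model; `handles_elem` and `outputs_of_step` show that it does so within the space bound. -/

/-! ## Incremental weights -/

/-- The weight of `x` in the list `L`: the marginal value of `x` with respect to the part of `L`
behind `x`. -/
def incWeight {α : Type} [DecidableEq α] (f : Finset α → ℝ) : List α → α → ℝ
  | [], _ => 0
  | a :: L, x => if x = a then f (insert a L.toFinset) - f L.toFinset else incWeight f L x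

/-- The marginal value of `o` with respect to `S \ {o}`. -/
def marginal {α : Type} [DecidableEq α] (f : Finset α → ℝ) (S : Finset α) (o : α) : ℝ :=
  f (insert o (S.erase o)) - f (S.erase o)

section weights

variable {α : Type} [DecidableEq α] {E : Finset α} {f : Finset α → ℝ}

theorem IsSubmodularOn.insert_sub_le (hf : IsSubmodularOn E f) {A B : Finset α} {x : α}
    (hAB : A ⊆ B) (hB : B ⊆ E) (hx : x ∈ E) (hxB : x ∉ B) :
    f (insert x B) - f B ≤ f (insert x A) - f A := by
  have h := hf.submodular (insert x A) (insert_subset hx (hAB.trans hB)) B hB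
  have h1 : insert x A ∪ B = insert x B := by
    rw [insert_union, union_eq_right.2 hAB]
  have h2 : insert x A ∩ B = A := by
    rw [insert_inter_of_notMem hxB, inter_eq_left.2 hAB]
  rw [h1, h2] at h
  linarith

theorem IsSubmodularOn.insert_sub_nonneg (hf : IsSubmodularOn E f) {A : Finset α} {x : α}
    (hA : A ⊆ E) (hx : x ∈ E) : 0 ≤ f (insert x A) - f A :=
  sub_nonneg.2 (hf.mono _ _ (subset_insert _ _) (insert_subset hx hA))

theorem IsSubmodularOn.marginal_nonneg (hf : IsSubmodularOn E f) {S : Finset α} {o : α}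
    (hS : S ⊆ E) (ho : o ∈ E) : 0 ≤ marginal f S o :=
  hf.insert_sub_nonneg ((erase_subset _ _).trans hS) ho

theorem IsSubmodularOn.marginal_le (hf : IsSubmodularOn E f) {A S : Finset α} {o : α}
    (hA : A ⊆ S) (hS : S ⊆ E) (ho : o ∈ E) (hoA : o ∉ A) :
    marginal f S o ≤ f (insert o A) - f A := by
  refine hf.insert_sub_le ?_ ((erase_subset _ _).trans hS) ho (notMem_erase _ _)
  exact fun x hx => mem_erase.2 ⟨fun h => hoA (h ▸ hx), hA hx⟩

theorem IsSubmodularOn.marginal_anti (hf : IsSubmodularOn E f) {S S' : Finset α} {o : α}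
    (h : S ⊆ S') (hS : S' ⊆ E) (ho : o ∈ E) : marginal f S' o ≤ marginal f S o :=
  hf.insert_sub_le (erase_subset_erase _ h) ((erase_subset _ _).trans hS) ho (notMem_erase _ _)

theorem incWeight_of_notMem {L : List α} {x : α} (hx : x ∉ L) : incWeight f L x = 0 := by
  induction L with
  | nil => rfl
  | cons a L ih =>
    rw [List.mem_cons, not_or] at hx
    rw [incWeight, if_neg hx.1, ih hx.2]

theorem incWeight_cons_self (L : List α) (a : α) :
    incWeight f (a :: L) a = f (insert a L.toFinset) - f L.toFinset := by
  simp [incWeight]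

theorem incWeight_cons_of_ne (L : List α) {a x : α} (h : x ≠ a) :
    incWeight f (a :: L) x = incWeight f L x := by
  simp [incWeight, h]

theorem IsSubmodularOn.incWeight_nonneg (hf : IsSubmodularOn E f) {L : List α}
    (hL : L.toFinset ⊆ E) (x : α) : 0 ≤ incWeight f L x := by
  induction L with
  | nil => exact le_rfl
  | cons a L ih =>
    rw [List.toFinset_cons, insert_subset_iff] at hL
    rw [incWeight]
    split_ifs
    · exact hf.insert_sub_nonneg hL.2 hL.1
    · exact ih hL.2

theorem sum_incWeight (h0 : f ∅ = 0) {L : List α} (hL : L.Nodup) :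
    ∑ x ∈ L.toFinset, incWeight f L x = f L.toFinset := by
  induction L with
  | nil => simp [h0]
  | cons a L ih =>
    rw [List.nodup_cons] at hL
    have ha : a ∉ L.toFinset := by simpa using hL.1
    rw [List.toFinset_cons, sum_insert ha, incWeight_cons_self,
      sum_congr rfl fun x hx => incWeight_cons_of_ne L (ne_of_mem_of_not_mem hx ha), ih hL.2]
    ring

/-- Deletions shrink the set behind each surviving element, so submodularity can only raise its
marginal value. Hence weights never drop while an element stays in the solution. -/
theorem IsSubmodularOn.incWeight_le_of_sublist (hf : IsSubmodularOn E f) {L' L : List α}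
    (h : L'.Sublist L) (hL : L.Nodup) (hE : L.toFinset ⊆ E) {x : α} (hx : x ∈ L') :
    incWeight f L x ≤ incWeight f L' x := by
  induction h with
  | slnil => exact le_rfl
  | @cons L' L a h ih =>
    rw [List.nodup_cons] at hL
    rw [List.toFinset_cons, insert_subset_iff] at hE
    rw [incWeight_cons_of_ne _ (ne_of_mem_of_not_mem (h.subset hx) hL.1)]
    exact ih hL.2 hE.2 hx
  | @cons_cons L' L a h ih =>
    rw [List.nodup_cons] at hL
    rw [List.toFinset_cons, insert_subset_iff] at hE
    by_cases hxa : x = a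
    · subst hxa
      rw [incWeight_cons_self, incWeight_cons_self]
      exact hf.insert_sub_le (fun y hy => by simpa using h.subset (by simpa using hy)) hE.2 hE.1
        (by simpa using hL.1)
    · rw [incWeight_cons_of_ne _ hxa, incWeight_cons_of_ne _ hxa]
      exact ih hL.2 hE.2 ((List.mem_cons.1 hx).resolve_left hxa)

theorem IsSubmodularOn.marginal_le_incWeight (hf : IsSubmodularOn E f) {L : List α}
    (hL : L.Nodup) {S : Finset α} (hLS : L.toFinset ⊆ S) (hS : S ⊆ E) {x : α} (hx : x ∈ L) :
    marginal f S x ≤ incWeight f L x := by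
  induction L with
  | nil => simp at hx
  | cons a L ih =>
    rw [List.nodup_cons] at hL
    rw [List.toFinset_cons, insert_subset_iff] at hLS
    by_cases hxa : x = a
    · subst hxa
      rw [incWeight_cons_self]
      exact hf.marginal_le hLS.2 hS (hS hLS.1) (by simpa using hL.1)
    · rw [incWeight_cons_of_ne _ hxa]
      exact ih hL.2 hLS.2 ((List.mem_cons.1 hx).resolve_left hxa)

/-- The effect on `f` of an exchange. -/
theorem IsSubmodularOn.exchange_gain (hf : IsSubmodularOn E f) {L : List α} (hL : L.Nodup)
    (hE : L.toFinset ⊆ E) {e : α} (he : e ∈ E) (heL : e ∉ L) {C : Finset α}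
    (hC : C ⊆ L.toFinset) :
    f L.toFinset + (f (insert e L.toFinset) - f L.toFinset) - ∑ x ∈ C, incWeight f L x ≤
      f (e :: L.filter (· ∉ C)).toFinset := by
  have hsub : (L.filter (· ∉ C)).Sublist L := List.filter_sublist
  have hset : (L.filter (· ∉ C)).toFinset = L.toFinset \ C := by ext; simp
  -- Deleting `C` raises the marginal of `e` (`h1`) and the weights of the survivors (`h4`), so the
  -- loss is at most the weight of `C`.
  have h1 : f (insert e L.toFinset) - f L.toFinset ≤
      f (insert e (L.toFinset \ C)) - f (L.toFinset \ C) :=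
    hf.insert_sub_le sdiff_subset hE he (by simpa using heL)
  have h2 := sum_incWeight hf.proper (hL.sublist hsub)
  have h3 := sum_incWeight hf.proper hL
  have h4 : ∑ x ∈ L.toFinset \ C, incWeight f L x ≤
      ∑ x ∈ L.toFinset \ C, incWeight f (L.filter (· ∉ C)) x :=
    sum_le_sum fun x hx => hf.incWeight_le_of_sublist hsub hL hE (by simpa using hx)
  have h5 := sum_sdiff (f := incWeight f L) hC
  rw [hset] at h2
  rw [List.toFinset_cons, hset]
  linarith

theorem incWeight_of_modular (w : α → ℝ) {L : List α} (hL : L.Nodup) {x : α} (hx : x ∈ L) :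
    incWeight (fun S => ∑ e ∈ S, w e) L x = w x := by
  induction L with
  | nil => simp at hx
  | cons a L ih =>
    rw [List.nodup_cons] at hL
    by_cases hxa : x = a
    · subst hxa
      rw [incWeight_cons_self, sum_insert (by simpa using hL.1)]
      ring
    · rw [incWeight_cons_of_ne _ hxa]
      exact ih hL.2 ((List.mem_cons.1 hx).resolve_left hxa)

theorem marginal_of_modular (w : α → ℝ) (S : Finset α) (x : α) :
    marginal (fun S => ∑ e ∈ S, w e) S x = w x := by
  rw [marginal, sum_insert (notMem_erase _ _)]
  ring

theorem isSubmodularOn_modular {w : α → ℝ} (hw : ∀ e ∈ E, 0 ≤ w e) :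
    IsSubmodularOn E fun S => ∑ e ∈ S, w e where
  proper := sum_empty
  nonneg _ hA := sum_nonneg fun e he => hw e (hA he)
  mono _ _ hAB hB := sum_le_sum_of_subset_of_nonneg hAB fun e he _ => hw e (hB he)
  submodular _ _ _ _ := (sum_union_inter).le

/-- The value of a set, compared with a sum of marginal values. -/
theorem IsSubmodularOn.le_add_sum_marginal (hf : IsSubmodularOn E f) {S J : Finset α}
    (hS : S ⊆ E) (hJ : J ⊆ E) : f J ≤ f S + ∑ o ∈ J, marginal f S o := by
  refine (hf.mono J (S ∪ J) subset_union_right (union_subset hS hJ)).trans ?_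
  induction J using Finset.induction_on with
  | empty => simp
  | insert o J ho ih =>
    rw [insert_subset_iff] at hJ
    rw [sum_insert ho, union_insert]
    have h1 := hf.marginal_nonneg hS hJ.1
    have h2 := ih hJ.2
    -- An `o` already present adds nothing to the left side, and its marginal on the right is
    -- non-negative.
    by_cases hoS : o ∈ S ∪ J
    · rw [insert_eq_of_mem hoS]; linarith
    · have h3 : f (insert o (S ∪ J)) - f (S ∪ J) ≤ marginal f S o :=
        hf.insert_sub_le ((erase_subset _ _).trans subset_union_left)
          (union_subset hS hJ.2) hJ.1 hoS
      linarith

end weights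

/-- Multisets of real numbers are compared by their level sets. -/
theorem Multiset.sum_le_sum_of_countP_le {s t : Multiset ℝ} (ht : ∀ b ∈ t, 0 ≤ b)
    (h : ∀ θ, 0 < θ → s.countP (θ ≤ ·) ≤ t.countP (θ ≤ ·)) : s.sum ≤ t.sum := by
  induction hn : s.card generalizing s t with
  | zero =>
    rw [Multiset.card_eq_zero.1 hn, Multiset.sum_zero]
    exact Multiset.sum_nonneg ht
  | succ n ih =>
    have hs : s.toFinset.Nonempty := by
      rw [Finset.nonempty_iff_ne_empty, Ne, Multiset.toFinset_eq_empty]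
      rintro rfl
      simp at hn
    -- The maximum `a` of `s` is matched with some `b ≥ a` in `t`. Removing both lowers both counts
    -- by one at levels up to `a`; above `a` nothing of `s` is left to count.
    obtain ⟨a, ha, hmax⟩ := s.toFinset.exists_max_image id hs
    rw [Multiset.mem_toFinset] at ha
    by_cases ha0 : a ≤ 0
    · refine le_trans ?_ (Multiset.sum_nonneg ht)
      simpa using s.sum_le_card_nsmul 0 fun x hx =>
        (hmax x (Multiset.mem_toFinset.2 hx)).trans ha0
    · have hpos : 0 < t.countP (a ≤ ·) :=
        (Multiset.countP_pos.2 ⟨a, ha, le_rfl⟩).trans_le (h a (not_le.1 ha0))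
      obtain ⟨b, hb, hab⟩ := Multiset.countP_pos.1 hpos
      obtain ⟨s', rfl⟩ := Multiset.exists_cons_of_mem ha
      obtain ⟨t', rfl⟩ := Multiset.exists_cons_of_mem hb
      rw [Multiset.sum_cons, Multiset.sum_cons]
      refine add_le_add hab
        (ih (fun x hx => ht x (Multiset.mem_cons_of_mem hx)) ?_ (by simpa using hn))
      intro θ hθ
      by_cases hθa : θ ≤ a
      · have := h θ hθ
        rw [Multiset.countP_cons_of_pos _ hθa,
          Multiset.countP_cons_of_pos _ (hθa.trans hab)] at this
        exact Nat.le_of_add_le_add_right this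
      · rw [Multiset.countP_eq_zero.2]
        · exact Nat.zero_le _
        · intro x hx hθx
          exact hθa (hθx.trans (hmax x (by simp [hx])))

/-! ## Exchanges in systems of closure operators -/

/-- A family of closure operators on `α`, the `i`-th of which only matters for the elements `e` with
`i ∈ N e`; there are at least one and at most `p` such indices for each `e`. -/
structure ClosureSystem (α ι : Type) (p : ℕ) where
  N : α → Finset ι
  cl : ι → ClosureOperator (Set α)
  one_le_card : ∀ e, 1 ≤ #(N e)
  card_le : ∀ e, #(N e) ≤ p

namespace ClosureSystem

variable {α ι : Type} {p : ℕ}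

/-- No subset of `J` is spanned by a smaller set. -/
def Indep (Φ : ClosureSystem α ι p) (J : Finset α) : Prop :=
  ∀ i, ∀ A B : Finset α, A ⊆ J → (∀ o ∈ A, i ∈ Φ.N o) → (A : Set α) ⊆ Φ.cl i B → #A ≤ #B

/-- The set `C` consists of elements of minimum weight of certain sets `T i ⊆ L` that span `e` and
in which they may be replaced by `e`. -/
def IsConflict [DecidableEq α] (Φ : ClosureSystem α ι p) (w : α → ℝ) (L : Finset α)
    (e : α) (C : Finset α) : Prop :=
  ∃ (I : Finset ι) (T : ι → Finset α) (x : ι → α), I ⊆ Φ.N e ∧ C = I.image x ∧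
    ∀ i ∈ I, T i ⊆ L ∧ x i ∈ T i ∧ (∀ y ∈ T i, w (x i) ≤ w y ∧ i ∈ Φ.N y) ∧
      e ∈ Φ.cl i (T i) ∧ x i ∈ Φ.cl i (insert e (T i \ {x i} : Set α))

theorem IsConflict.subset [DecidableEq α] {Φ : ClosureSystem α ι p} {w : α → ℝ} {L : Finset α}
    {e : α} {C : Finset α} (h : Φ.IsConflict w L e C) : C ⊆ L := by
  obtain ⟨I, T, x, -, rfl, h⟩ := h
  intro y hy
  obtain ⟨i, hi, rfl⟩ := mem_image.1 hy
  exact (h i hi).1 (h i hi).2.1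

theorem IsConflict.congr [DecidableEq α] {Φ : ClosureSystem α ι p} {w w' : α → ℝ} {L : Finset α}
    {e : α} {C : Finset α} (h : Φ.IsConflict w L e C) (hw : ∀ x ∈ L, w x = w' x) :
    Φ.IsConflict w' L e C := by
  obtain ⟨I, T, x, hI, hC, h⟩ := h
  refine ⟨I, T, x, hI, hC, fun i hi => ?_⟩
  obtain ⟨h1, h2, h3, h4⟩ := h i hi
  refine ⟨h1, h2, fun y hy => ?_, h4⟩
  rw [← hw _ (h1 h2), ← hw _ (h1 hy)]
  exact h3 y hy

/-- What is known about the solution `L` in the course of a pass that started with a solution of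
value `v₀`: all elements that were in the solution are in `S`; the removed elements have total
weight `κ`, and those that were not replaced in the `i`-th system are listed in `dead i`. -/
structure PassInvariant [DecidableEq α] [Fintype ι] (Φ : ClosureSystem α ι p)
    (E : Finset α) (f : Finset α → ℝ) (r v₀ : ℝ) (L : List α)
    (S : Finset α) (dead : ι → Multiset (α × ℝ)) (κ : ℝ) : Prop where
  nodup : L.Nodup
  subset : L.toFinset ⊆ S
  subset_ground : S ⊆ E
  nonneg : 0 ≤ κ
  gain : (r - 1) * κ ≤ f L.toFinset - v₀
  value : f S ≤ f L.toFinset + κ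
  dead_nonneg : ∀ i, ∀ y ∈ dead i, 0 ≤ y.2
  dead_sum : ∑ i, ((dead i).map Prod.snd).sum ≤ (p - 1) * κ

theorem passInvariant_init [DecidableEq α] [Fintype ι] (Φ : ClosureSystem α ι p) {E : Finset α}
    {f : Finset α → ℝ} {L : List α} (r : ℝ) (hL : L.Nodup)
    (hE : L.toFinset ⊆ E) :
    Φ.PassInvariant E f r (f L.toFinset) L L.toFinset (fun _ => 0) 0 where
  nodup := hL
  subset := Subset.rfl
  subset_ground := hE
  nonneg := le_rfl
  gain := by simp
  value := by simp
  dead_nonneg := by simp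
  dead_sum := by simp

variable [DecidableEq ι]

/-- The elements of a list with index `i`, together with their weights. -/
def live (Φ : ClosureSystem α ι p) (w : α → ℝ) (L : Finset α) (i : ι) : Multiset (α × ℝ) :=
  (L.filter (i ∈ Φ.N ·)).val.map fun y => (y, w y)

/-- The elements that occur in `D` with weight at least `θ`. -/
def level (D : Multiset (α × ℝ)) (θ : ℝ) : Set α := {y | ∃ v, θ ≤ v ∧ (y, v) ∈ D}

theorem mem_live {Φ : ClosureSystem α ι p} {w : α → ℝ} {L : Finset α} {i : ι} {y : α} {v : ℝ} :
    (y, v) ∈ Φ.live w L i ↔ y ∈ L ∧ i ∈ Φ.N y ∧ v = w y := by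
  simp only [live, Multiset.mem_map, mem_val, mem_filter, Prod.mk.injEq]
  constructor
  · rintro ⟨a, ⟨h1, h2⟩, rfl, rfl⟩; exact ⟨h1, h2, rfl⟩
  · rintro ⟨h1, h2, rfl⟩; exact ⟨y, ⟨h1, h2⟩, rfl, rfl⟩

/-- The value of `o` is bounded by numbers `l i` such that `o` is spanned by elements of weight at
least `l i` in the `i`-th system. -/
def Covered [DecidableEq α] (Φ : ClosureSystem α ι p) (f : Finset α → ℝ) (r : ℝ)
    (L : List α) (S : Finset α)
    (dead : ι → Multiset (α × ℝ)) (o : α) : Prop :=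
  ∃ l : ι → ℝ, (∀ i, 0 ≤ l i) ∧ marginal f S o ≤ r * ∑ i ∈ Φ.N o, l i ∧
    ∀ i ∈ Φ.N o, 0 < l i → o ∈ Φ.cl i (level (Φ.live (incWeight f L) L.toFinset i + dead i) (l i))

variable [DecidableEq α] [Fintype ι] {Φ : ClosureSystem α ι p} {E : Finset α} {f : Finset α → ℝ}
  {r v₀ : ℝ} {L : List α} {S : Finset α} {dead : ι → Multiset (α × ℝ)} {κ : ℝ}

/-- An element of the solution spans itself and is charged its own weight. At least one index must
be available for this charge, whence `one_le_card`. -/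
theorem covered_of_mem (hf : IsSubmodularOn E f) (hr : 1 ≤ r)
    (h : Φ.PassInvariant E f r v₀ L S dead κ) {e : α} (he : e ∈ L) :
    Φ.Covered f r L S dead e := by
  have h0 : 0 ≤ incWeight f L e := hf.incWeight_nonneg (h.subset.trans h.subset_ground) e
  refine ⟨fun _ => incWeight f L e, fun _ => h0, ?_, fun i hi _ => ?_⟩
  · rw [sum_const, nsmul_eq_mul]
    have h1 : (1 : ℝ) ≤ #(Φ.N e) := by exact_mod_cast Φ.one_le_card e
    refine (hf.marginal_le_incWeight h.nodup h.subset h.subset_ground he).trans ?_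
    nlinarith [mul_le_mul hr h1 zero_le_one (zero_le_one.trans hr)]
  · exact (Φ.cl i).le_closure _ ⟨_, le_rfl, Multiset.mem_add.2
      (Or.inl (mem_live.2 ⟨List.mem_toFinset.2 he, hi, rfl⟩))⟩

/-- The levels are the weights of the conflict elements. In a constraint without conflict the level
is `0`, so that no spanning is demanded there. -/
theorem covered_of_reject (hf : IsSubmodularOn E f) (hr : 1 ≤ r)
    (h : Φ.PassInvariant E f r v₀ L S dead κ) {e : α} (he : e ∈ E) (heL : e ∉ L) {C : Finset α}
    (hC : Φ.IsConflict (incWeight f L) L.toFinset e C)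
    (hlt : f (insert e L.toFinset) - f L.toFinset ≤ r * ∑ x ∈ C, incWeight f L x) :
    Φ.Covered f r L S dead e := by
  have h0 : ∀ x, 0 ≤ incWeight f L x := hf.incWeight_nonneg (h.subset.trans h.subset_ground)
  obtain ⟨I, T, x, hI, rfl, hT⟩ := hC
  refine ⟨fun i => if i ∈ I then incWeight f L (x i) else 0, fun i => ?_, ?_, fun i hi hpos => ?_⟩
  · dsimp only; split_ifs
    · exact h0 _
    · exact le_rfl
  · refine (hf.marginal_le h.subset h.subset_ground he (by simpa using heL)).trans
      (hlt.trans (mul_le_mul_of_nonneg_left ?_ (zero_le_one.trans hr)))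
    rw [← sum_filter, filter_mem_eq_inter, inter_eq_right.2 hI]
    -- Several indices may share a conflict element, so `C` weighs at most the sum over the indices.
    exact sum_image_le_of_nonneg fun i _ => h0 _
  · dsimp only at hpos ⊢
    split_ifs at hpos ⊢ with hiI
    · refine (Φ.cl i).monotone (fun y hy => ?_) (hT i hiI).2.2.2.1
      obtain ⟨hw, hN⟩ := (hT i hiI).2.2.1 y hy
      exact ⟨_, hw, Multiset.mem_add.2 (Or.inl (mem_live.2 ⟨(hT i hiI).1 hy, hN, rfl⟩))⟩
    · exact absurd hpos (lt_irrefl _)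

/-- An exchange preserves the invariant and the covered elements. -/
theorem accept_step (hf : IsSubmodularOn E f) (hr : 1 ≤ r)
    (h : Φ.PassInvariant E f r v₀ L S dead κ) {e : α} (he : e ∈ E) (heL : e ∉ L) {C : Finset α}
    (hC : Φ.IsConflict (incWeight f L) L.toFinset e C)
    (hge : r * ∑ x ∈ C, incWeight f L x ≤ f (insert e L.toFinset) - f L.toFinset) :
    ∃ S' dead' κ', Φ.PassInvariant E f r v₀ (e :: L.filter (· ∉ C)) S' dead' κ' ∧
      ∀ o ∈ E, Φ.Covered f r L S dead o → Φ.Covered f r (e :: L.filter (· ∉ C)) S' dead' o := by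
  have hLE := h.subset.trans h.subset_ground
  have h0 : ∀ x, 0 ≤ incWeight f L x := hf.incWeight_nonneg hLE
  have hCL := hC.subset
  have hgain := hf.exchange_gain h.nodup hLE he heL hCL
  have hC0 : 0 ≤ ∑ x ∈ C, incWeight f L x := sum_nonneg fun x _ => h0 x
  have hsub : (L.filter (· ∉ C)).Sublist L := List.filter_sublist
  have hset : (L.filter (· ∉ C)).toFinset = L.toFinset \ C := by ext; simp
  have hew : 0 ≤ f (insert e L.toFinset) - f L.toFinset := hf.insert_sub_nonneg hLE he
  obtain ⟨I, T, x, hI, hCI, hT⟩ := hC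
  -- The removed elements for which `e` is no substitute in the `i`-th system; they stay available
  -- for charging as dead elements.
  let out : ι → Finset α := fun i => C.filter fun y => i ∈ Φ.N y ∧ ¬ (i ∈ I ∧ x i = y)
  let new : ι → Multiset (α × ℝ) := fun i => (out i).val.map fun y => (y, incWeight f L y)
  have hmem : ∀ i y v, (y, v) ∈ new i ↔ y ∈ out i ∧ v = incWeight f L y := by
    intro i y v
    simp only [new, Multiset.mem_map, mem_val, Prod.mk.injEq]
    constructor
    · rintro ⟨a, h1, rfl, rfl⟩; exact ⟨h1, rfl⟩
    · rintro ⟨h1, rfl⟩; exact ⟨y, h1, rfl, rfl⟩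
  refine ⟨insert e S, fun i => new i + dead i, κ + ∑ x ∈ C, incWeight f L x, ⟨?_, ?_, ?_, ?_, ?_,
    ?_, ?_, ?_⟩, ?_⟩
  · exact List.nodup_cons.2 ⟨fun h' => heL (hsub.subset h'), h.nodup.sublist hsub⟩
  · rw [List.toFinset_cons, hset]
    exact insert_subset_insert _ (sdiff_subset.trans h.subset)
  · exact insert_subset he h.subset_ground
  · exact add_nonneg h.nonneg hC0
  -- The gain is at least `f (insert e L) - f L` minus the weight of `C`, and the first term is at
  -- least `r` times that weight.
  · have := h.gain
    nlinarith
  -- `S` gains at most the marginal of `e` over `L`, while the solution gains at least that minus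
  -- the weight of `C`, which is added to `κ`.
  · have h1 := h.value
    by_cases heS : e ∈ S
    · rw [insert_eq_of_mem heS]; linarith
    · have := hf.insert_sub_le h.subset h.subset_ground he heS
      linarith
  · rintro i ⟨y, v⟩ hy
    rcases Multiset.mem_add.1 hy with hy | hy
    · rw [((hmem i y v).1 hy).2]; exact h0 y
    · exact h.dead_nonneg i _ hy
  · have h1 : ∀ i, ((new i + dead i).map Prod.snd).sum =
        ∑ y ∈ out i, incWeight f L y + ((dead i).map Prod.snd).sum := by
      intro i
      rw [Multiset.map_add, Multiset.sum_add]
      simp [new]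
    have h2 : ∑ i, ∑ y ∈ out i, incWeight f L y ≤ (p - 1) * ∑ y ∈ C, incWeight f L y := by
      simp only [out, sum_filter]
      rw [sum_comm, mul_sum]
      refine sum_le_sum fun y hy => ?_
      rw [← sum_filter, sum_const, nsmul_eq_mul]
      refine mul_le_mul_of_nonneg_right ?_ (h0 y)
      rw [hCI] at hy
      obtain ⟨j, hj, hjy⟩ := mem_image.1 hy
      have hjN : j ∈ Φ.N y := hjy ▸ ((hT j hj).2.2.1 _ (hT j hj).2.1).2
      -- The index `j` that selected `y` does not count it as dead, which leaves at most `p - 1`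
      -- copies.
      have h3 : #({i | i ∈ Φ.N y ∧ ¬ (i ∈ I ∧ x i = y)} : Finset ι) < #(Φ.N y) :=
        card_lt_card (ssubset_iff_of_subset (fun i hi => (mem_filter.1 hi).2.1) |>.2
          ⟨j, hjN, fun h' => (mem_filter.1 h').2.2 ⟨hj, hjy⟩⟩)
      have h4 : #({i | i ∈ Φ.N y ∧ ¬ (i ∈ I ∧ x i = y)} : Finset ι) + 1 ≤ p :=
        (Nat.succ_le_of_lt h3).trans (Φ.card_le y)
      have h5 : ((#({i | i ∈ Φ.N y ∧ ¬ (i ∈ I ∧ x i = y)} : Finset ι) : ℕ) : ℝ) + 1 ≤ p := by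
        exact_mod_cast h4
      linarith
    simp only [h1, sum_add_distrib]
    have := h.dead_sum
    linarith
  · rintro o ho ⟨l, hl0, hl1, hl2⟩
    refine ⟨l, hl0, (hf.marginal_anti (subset_insert _ _) (insert_subset he h.subset_ground)
      ho).trans hl1, fun i hi hpos => ?_⟩
    -- It suffices that the closure of the new level set contains each member of the old one.
    refine (Φ.cl i).closure_min ?_ ((Φ.cl i).isClosed_closure _) (hl2 i hi hpos)
    have hlive : ∀ y ∈ L, y ∉ C → i ∈ Φ.N y → l i ≤ incWeight f L y →
        y ∈ level (Φ.live (incWeight f (e :: L.filter (· ∉ C))) (e :: L.filter (· ∉ C)).toFinset i +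
          (new i + dead i)) (l i) := by
      intro y hyL hyC hyN hly
      have hyF : y ∈ L.filter (· ∉ C) := by simp [hyL, hyC]
      refine ⟨_, hly.trans ?_, Multiset.mem_add.2 (Or.inl (mem_live.2 ⟨?_, hyN, rfl⟩))⟩
      · rw [incWeight_cons_of_ne _ (ne_of_mem_of_not_mem hyL heL)]
        exact hf.incWeight_le_of_sublist hsub h.nodup hLE hyF
      · rw [List.toFinset_cons, mem_insert, List.mem_toFinset]
        exact Or.inr hyF
    have hdead : ∀ y ∈ C, i ∈ Φ.N y → ¬ (i ∈ I ∧ x i = y) → l i ≤ incWeight f L y →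
        y ∈ level (Φ.live (incWeight f (e :: L.filter (· ∉ C))) (e :: L.filter (· ∉ C)).toFinset i +
          (new i + dead i)) (l i) := by
      intro y hyC hyN hyx hly
      exact ⟨_, hly, Multiset.mem_add.2 (Or.inr (Multiset.mem_add.2 (Or.inl
        ((hmem _ _ _).2 ⟨mem_filter.2 ⟨hyC, hyN, hyx⟩, rfl⟩))))⟩
    rintro y ⟨v, hv, hy⟩
    rcases Multiset.mem_add.1 hy with hy | hy
    · obtain ⟨hyL, hyN, rfl⟩ := mem_live.1 hy
      rw [List.mem_toFinset] at hyL
      by_cases hyC : y ∈ C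
      · by_cases hyx : i ∈ I ∧ x i = y
        · obtain ⟨hiI, rfl⟩ := hyx
          obtain ⟨hTL, hxT, hTw, -, hcl⟩ := hT i hiI
          refine (Φ.cl i).monotone ?_ hcl
          rintro z (rfl | ⟨hz, hzx⟩)
          · refine ⟨_, hv.trans ?_, Multiset.mem_add.2 (Or.inl (mem_live.2
              ⟨by simp, hI hiI, rfl⟩))⟩
            -- Here `r ≥ 1` matters: `e` weighs at least `r` times all of `C`, hence at least as
            -- much as the element `x i` it replaces.
            rw [incWeight_cons_self, hset]
            have h1 := hf.insert_sub_le (A := L.toFinset \ C) sdiff_subset hLE he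
              (by simpa using heL)
            have h2 := single_le_sum (f := incWeight f L) (fun x _ => h0 x) hyC
            nlinarith
          · obtain ⟨hzw, hzN⟩ := hTw z hz
            by_cases hzC : z ∈ C
            · exact hdead z hzC hzN (fun h' => hzx h'.2.symm) (hv.trans hzw)
            · exact hlive z (List.mem_toFinset.1 (hTL hz)) hzC hzN (hv.trans hzw)
        · exact (Φ.cl i).le_closure _ (hdead y hyC hyN hyx hv)
      · exact (Φ.cl i).le_closure _ (hlive y hyL hyC hyN hv)
    · exact (Φ.cl i).le_closure _ ⟨v, hv, Multiset.mem_add.2 (Or.inr (Multiset.mem_add.2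
        (Or.inr hy)))⟩

/-- The bound obtained at the end of a pass. -/
theorem sum_marginal_le (hf : IsSubmodularOn E f) (hr : 1 ≤ r)
    (h : Φ.PassInvariant E f r v₀ L S dead κ) {J : Finset α} (hJ : Φ.Indep J)
    (hcov : ∀ o ∈ J, Φ.Covered f r L S dead o) :
    ∑ o ∈ J, marginal f S o ≤ r * (p * f L.toFinset + (p - 1) * κ) := by
  have hLE := h.subset.trans h.subset_ground
  have h0 : ∀ x, 0 ≤ incWeight f L x := hf.incWeight_nonneg hLE
  choose! l hl0 hl1 hl2 using hcov
  refine (sum_le_sum hl1).trans ?_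
  rw [← mul_sum]
  refine mul_le_mul_of_nonneg_left ?_ (zero_le_one.trans hr)
  have hswap : ∑ o ∈ J, ∑ i ∈ Φ.N o, l o i = ∑ i, ∑ o ∈ J with i ∈ Φ.N o, l o i := by
    simp only [sum_filter]
    rw [sum_comm]
    exact sum_congr rfl fun o _ => by rw [← sum_filter, filter_mem_eq_inter, univ_inter]
  -- At each level `θ > 0`, the members of `J` charging at least `θ` are spanned by the live and
  -- dead elements of weight at least `θ`, so independence of `J` bounds their number.
  have hone : ∀ i, ∑ o ∈ J with i ∈ Φ.N o, l o i ≤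
      ((Φ.live (incWeight f L) L.toFinset i + dead i).map Prod.snd).sum := by
    intro i
    refine Multiset.sum_le_sum_of_countP_le ?_ fun θ hθ => ?_
    · intro b hb
      obtain ⟨⟨y, v⟩, hy, rfl⟩ := Multiset.mem_map.1 hb
      rcases Multiset.mem_add.1 hy with hy | hy
      · rw [(mem_live.1 hy).2.2]; exact h0 y
      · exact h.dead_nonneg i _ hy
    · set D := Φ.live (incWeight f L) L.toFinset i + dead i with hD
      rw [Multiset.countP_map, Multiset.countP_map]
      let A := (J.filter (i ∈ Φ.N ·)).filter (θ ≤ l · i)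
      let B := ((D.filter (θ ≤ ·.2)).map Prod.fst).toFinset
      have h1 : #A ≤ #B := by
        refine hJ i A B ((filter_subset _ _).trans (filter_subset _ _)) (fun o ho => ?_)
          fun o ho => ?_
        · exact (mem_filter.1 (mem_filter.1 ho).1).2
        · obtain ⟨ho1, hoθ⟩ := mem_filter.1 ho
          obtain ⟨hoJ, hoN⟩ := mem_filter.1 ho1
          refine (Φ.cl i).monotone ?_ (hl2 o hoJ i hoN (hθ.trans_le hoθ))
          rintro y ⟨v, hv, hy⟩
          simp only [B, Multiset.mem_toFinset, mem_coe, Multiset.mem_map,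
            Multiset.mem_filter]
          exact ⟨(y, v), ⟨hy, hoθ.trans hv⟩, rfl⟩
      exact h1.trans ((Multiset.toFinset_card_le _).trans (Multiset.card_map _ _).le)
  have hlive : ∑ i, ((Φ.live (incWeight f L) L.toFinset i).map Prod.snd).sum ≤
      p * f L.toFinset := by
    have h1 : ∀ i, ((Φ.live (incWeight f L) L.toFinset i).map Prod.snd).sum =
        ∑ y ∈ L.toFinset with i ∈ Φ.N y, incWeight f L y := by
      intro i
      rw [live, Multiset.map_map]
      rfl
    simp only [h1, sum_filter]
    rw [sum_comm, ← sum_incWeight hf.proper h.nodup, mul_sum]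
    refine sum_le_sum fun y _ => ?_
    rw [← sum_filter, filter_mem_eq_inter, univ_inter, sum_const, nsmul_eq_mul]
    exact mul_le_mul_of_nonneg_right (by exact_mod_cast Φ.card_le y) (h0 y)
  have hdead := h.dead_sum
  rw [hswap]
  refine (sum_le_sum fun i _ => hone i).trans ?_
  simp only [Multiset.map_add, Multiset.sum_add, sum_add_distrib]
  linarith

end ClosureSystem

/-! ## The local search step and its iterations -/

/-- The element `e` is exchanged for the conflict set `C` if its weight is at least `r` times as
large; nothing happens if `e` belongs to `L`, or if there is no conflict set. -/
noncomputable def exchangeStep {α : Type} [DecidableEq α] (r : ℝ) (C : Option (Finset α)) (e : α)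
    (L : List α) (w : α → ℝ) : List α :=
  if e ∈ L then L else
    match C with
    | none => L
    | some C => if r * ∑ x ∈ C, w x ≤ w e then e :: L.filter (· ∉ C) else L

theorem exchangeStep_of_mem {α : Type} [DecidableEq α] (r : ℝ) (C : Option (Finset α)) {e : α}
    {L : List α} (w : α → ℝ) (h : e ∈ L) : exchangeStep r C e L w = L := if_pos h

theorem exchangeStep_subset {α : Type} [DecidableEq α] (r : ℝ) (C : Option (Finset α)) (e : α)
    (L : List α) (w : α → ℝ) : exchangeStep r C e L w ⊆ e :: L := by
  unfold exchangeStep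
  split_ifs
  · exact List.subset_cons_self _ _
  · cases C with
    | none => exact List.subset_cons_self _ _
    | some C =>
      dsimp only
      split_ifs
      · exact List.cons_subset_cons _ List.filter_sublist.subset
      · exact List.subset_cons_self _ _

/-- The lists that represent solutions. -/
structure IsSolution {α : Type} [DecidableEq α] (E : Finset α) (ind : Finset α → Prop)
    (L : List α) : Prop where
  nodup : L.Nodup
  subset : L.toFinset ⊆ E
  indep : ind L.toFinset

namespace ClosureSystem

variable {α ι : Type} [DecidableEq α] [DecidableEq ι] {p : ℕ}

/-- The rule `c` determines conflict sets for the independence system `ind`. -/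
structure IsRule (Φ : ClosureSystem α ι p) (E : Finset α) (ind : Finset α → Prop)
    (c : List α → α → (α → ℝ) → Option (Finset α)) : Prop where
  indep : ∀ J ⊆ E, ind J → Φ.Indep J
  none : ∀ L e w, IsSolution E ind L → e ∈ E → e ∉ L → c L e w = none → ∀ J, ind J → e ∉ J
  some : ∀ L e w C, IsSolution E ind L → e ∈ E → e ∉ L → c L e w = some C →
    Φ.IsConflict w L.toFinset e C ∧ ind (insert e (L.toFinset \ C))

/-- The step of the local search for `f`. -/
noncomputable def searchStep (f : Finset α → ℝ) (r : ℝ)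
    (c : List α → α → (α → ℝ) → Option (Finset α)) (L : List α) (e : α) : List α :=
  exchangeStep r (c L e (incWeight f (e :: L))) e L (incWeight f (e :: L))

variable [Fintype ι] {Φ : ClosureSystem α ι p} {E : Finset α} {ind : Finset α → Prop}
  {c : List α → α → (α → ℝ) → Option (Finset α)} {f : Finset α → ℝ} {r v₀ : ℝ}

/-- An `e` without conflict set is dropped uncovered; it lies in no independent set, which is why
covering `e` carries that proviso. -/
theorem searchStep_invariant (hf : IsSubmodularOn E f) (hr : 1 ≤ r) (hc : Φ.IsRule E ind c)
    {L : List α} {S : Finset α} {dead : ι → Multiset (α × ℝ)} {κ : ℝ}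
    (h : Φ.PassInvariant E f r v₀ L S dead κ) (hL : ind L.toFinset) {e : α} (he : e ∈ E) :
    ind (searchStep f r c L e).toFinset ∧
    ∃ S' dead' κ', Φ.PassInvariant E f r v₀ (searchStep f r c L e) S' dead' κ' ∧
      (∀ o ∈ E, Φ.Covered f r L S dead o → Φ.Covered f r (searchStep f r c L e) S' dead' o) ∧
      ((∃ J, ind J ∧ e ∈ J) → Φ.Covered f r (searchStep f r c L e) S' dead' e) := by
  have hsol : IsSolution E ind L := ⟨h.nodup, h.subset.trans h.subset_ground, hL⟩
  unfold searchStep exchangeStep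
  split_ifs with heL
  · exact ⟨hL, S, dead, κ, h, fun o _ ho => ho, fun _ => covered_of_mem hf hr h heL⟩
  cases hC : c L e (incWeight f (e :: L)) with
  | none =>
    exact ⟨hL, S, dead, κ, h, fun o _ ho => ho, fun ⟨J, hJ, heJ⟩ =>
      absurd heJ (hc.none L e _ hsol he heL hC J hJ)⟩
  | some C =>
    obtain ⟨h1, h2⟩ := hc.some L e _ C hsol he heL hC
    have hw : ∀ x ∈ L.toFinset, incWeight f (e :: L) x = incWeight f L x := fun x hx =>
      incWeight_cons_of_ne _ (ne_of_mem_of_not_mem (List.mem_toFinset.1 hx) heL)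
    replace h1 := h1.congr hw
    have hset : (e :: L.filter (· ∉ C)).toFinset = insert e (L.toFinset \ C) := by ext; simp
    dsimp only
    rw [incWeight_cons_self, sum_congr rfl fun x hx => hw x (h1.subset hx)]
    split_ifs with hge
    · obtain ⟨S', dead', κ', h3, h4⟩ := accept_step hf hr h he heL h1 hge
      exact ⟨hset ▸ h2, S', dead', κ', h3, h4, fun _ =>
        covered_of_mem hf hr h3 List.mem_cons_self⟩
    · exact ⟨hL, S, dead, κ, h, fun o _ ho => ho, fun _ =>
        covered_of_reject hf hr h he heL h1 (not_le.1 hge).le⟩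

/-- Elements are covered on arrival and remain covered, although `S` and the dead lists keep
changing. -/
theorem foldl_searchStep_invariant (hf : IsSubmodularOn E f) (hr : 1 ≤ r)
    (hc : Φ.IsRule E ind c) (σ : List α) (hσ : ∀ e ∈ σ, e ∈ E) {L : List α} {S : Finset α}
    {dead : ι → Multiset (α × ℝ)} {κ : ℝ} (h : Φ.PassInvariant E f r v₀ L S dead κ)
    (hL : ind L.toFinset) :
    ind (σ.foldl (searchStep f r c) L).toFinset ∧
    ∃ S' dead' κ', Φ.PassInvariant E f r v₀ (σ.foldl (searchStep f r c) L) S' dead' κ' ∧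
      ∀ o ∈ E, Φ.Covered f r L S dead o ∨ (o ∈ σ ∧ ∃ J, ind J ∧ o ∈ J) →
        Φ.Covered f r (σ.foldl (searchStep f r c) L) S' dead' o := by
  induction σ generalizing L S dead κ with
  | nil => exact ⟨hL, S, dead, κ, h, fun o _ ho => ho.resolve_right (by simp)⟩
  | cons e σ ih =>
    obtain ⟨h1, S', dead', κ', h2, h3, h4⟩ :=
      searchStep_invariant hf hr hc h hL (hσ e List.mem_cons_self)
    obtain ⟨h5, S'', dead'', κ'', h6, h7⟩ :=
      ih (fun o ho => hσ o (List.mem_cons_of_mem _ ho)) h2 h1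
    refine ⟨h5, S'', dead'', κ'', h6, fun o hoE ho => h7 o hoE ?_⟩
    rcases ho with ho | ⟨ho, hJ⟩
    · exact Or.inl (h3 o hoE ho)
    · rcases List.mem_cons.1 ho with rfl | ho
      · exact Or.inl (h4 hJ)
      · exact Or.inr ⟨ho, hJ⟩

theorem isSolution_foldl {σ : List α} (hf : IsSubmodularOn E f) (hr : 1 ≤ r)
    (hc : Φ.IsRule E ind c) (hσ : ∀ e ∈ σ, e ∈ E) {L : List α} (hL : IsSolution E ind L) :
    IsSolution E ind (σ.foldl (searchStep f r c) L) := by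
  obtain ⟨h1, S, dead, κ, h2, -⟩ := foldl_searchStep_invariant hf hr hc σ hσ
    (passInvariant_init Φ r hL.nodup hL.subset) hL.indep
  exact ⟨h2.nodup, h2.subset.trans h2.subset_ground, h1⟩

/-- The progress made in one pass. -/
theorem pass_bound {σ : List α} (hf : IsSubmodularOn σ.toFinset f) (hr : 1 ≤ r)
    (hc : Φ.IsRule σ.toFinset ind c) {L L' : List α} (hL : IsSolution σ.toFinset ind L)
    (hL' : L' = σ.foldl (searchStep f r c) L) :
    ∃ κ, 0 ≤ κ ∧ (r - 1) * κ ≤ f L'.toFinset - f L.toFinset ∧ ∀ J ⊆ σ.toFinset, ind J →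
      f J ≤ f L'.toFinset + κ + r * (p * f L'.toFinset + (p - 1) * κ) ∧
      ∀ w : α → ℝ, f = (fun S => ∑ e ∈ S, w e) →
        f J ≤ r * (p * f L'.toFinset + (p - 1) * κ) := by
  subst hL'
  obtain ⟨-, S, dead, κ, h, hcov⟩ := foldl_searchStep_invariant hf hr hc σ
    (fun e he => List.mem_toFinset.2 he) (passInvariant_init Φ r hL.nodup hL.subset) hL.indep
  refine ⟨κ, h.nonneg, h.gain, fun J hJ hind => ?_⟩
  have h1 := sum_marginal_le hf hr h (hc.indep J hJ hind) fun o ho =>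
    hcov o (hJ ho) (Or.inr ⟨List.mem_toFinset.1 (hJ ho), J, hind, ho⟩)
  -- In general `f S` has to be paid for by `f L' + κ`; for a modular `f` the marginals of `J`
  -- already add up to `f J`.
  constructor
  · have h2 := hf.le_add_sum_marginal h.subset_ground hJ
    have h3 := h.value
    linarith
  · rintro w rfl
    simpa only [marginal_of_modular] using h1

end ClosureSystem

/-- Convergence of the repeated passes. -/
theorem le_mul_of_progress {X : ℕ → ℝ} {F a γ ρ : ℝ} {k : ℕ} (hX0 : X 0 = 0) (hXk : 0 ≤ X k)
    (ha : 0 < a) (hγ : 0 ≤ γ) (hρ : a < ρ) (hk : ρ ≤ (1 + k * γ) * (ρ - a))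
    (h : ∀ j, ∃ κ, γ * κ ≤ X (j + 1) - X j ∧ F ≤ a * X (j + 1) + a * κ) : F ≤ ρ * X k := by
  -- One pass divides the gap `F - a * X j` by at least `1 + γ`: `γ` times the new gap is at most `a
  -- * γ * κ`, hence at most `a` times the progress.
  have hstep : ∀ j, (1 + γ) ^ j * (F - a * X j) ≤ F := by
    intro j
    induction j with
    | zero => simp [hX0]
    | succ j ih =>
      obtain ⟨κ, h1, h2⟩ := h j
      refine le_trans ?_ ih
      rw [pow_succ, mul_assoc]
      refine mul_le_mul_of_nonneg_left ?_ (by positivity)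
      nlinarith [mul_le_mul_of_nonneg_left h2 hγ]
  by_cases hZ : F - a * X k ≤ 0
  · nlinarith
  · have h1 : 1 + k * γ ≤ (1 + γ) ^ k := one_add_mul_le_pow (by linarith) k
    have h2 : (1 + k * γ) * (F - a * X k) ≤ F :=
      (mul_le_mul_of_nonneg_right h1 (not_le.1 hZ).le).trans (hstep k)
    have h3 : ρ * (F - a * X k) ≤ (ρ - a) * F := by
      nlinarith [mul_le_mul_of_nonneg_right hk (not_le.1 hZ).le,
        mul_le_mul_of_nonneg_left h2 (sub_pos.2 hρ).le]
    nlinarith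

/-! ## A streaming implementation of local search -/

/-! ### Layout of the memory and its decoding -/

section decoding

variable {α : Type}

def Cell.num? : Cell α → Option ℕ
  | .num k => some k
  | _ => none

/-- The elements stored before the first number, between consecutive numbers, and after the last
number. -/
def groups : List (Cell α) → List (List α)
  | [] => [[]]
  | .elem a :: m => (groups m).modifyHead (a :: ·)
  | .val _ :: m => groups m
  | .num _ :: m => [] :: groups m

/-- The real numbers stored at the beginning of the memory. -/
def leadingVals : List (Cell α) → List ℝ
  | .val v :: m => v :: leadingVals m
  | _ => []

/-- The last number in the memory. -/
def lastNum (mem : List (Cell α)) : Option ℕ := (mem.filterMap Cell.num?).getLast?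

/-- The real number that follows the element `x` in the memory. -/
noncomputable def valAfter [DecidableEq α] : List (Cell α) → α → ℝ
  | .elem a :: .val v :: m, x => if x = a then v else valAfter m x
  | _ :: m, x => valAfter m x
  | [], _ => 0

/-- The weights of the elements of a list, obtained from the values of its suffixes. -/
noncomputable def suffixWeight [DecidableEq α] : List α → List ℝ → α → ℝ
  | a :: L, v :: v' :: vs, x => if x = a then v - v' else suffixWeight L (v' :: vs) x
  | _, _, _ => 0

/-- The positions at which elements of `S` are stored. -/
noncomputable def positions [DecidableEq α] (mem : List (Cell α)) (S : Finset α) : List ℕ :=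
  open Classical in
  (List.range mem.length).filter fun i => ∃ a ∈ S, mem[i]? = some (.elem a)

/-- A reference that evaluates to the given cell. -/
noncomputable def refTo (mem : List (Cell α)) : Cell α → Ref
  | .num k => .num k
  | c => open Classical in .copy (mem.idxOf c)

/-- The records by which the elements of a list are stored, `x a` being the list of real numbers
that belong to `a`. -/
def records (x : α → List ℝ) (L : List α) : List (Cell α) :=
  L.flatMap fun a => .elem a :: (x a).map .val

/-- The memory after the answers `ans` to independence queries. -/
noncomputable def workMem (x : α → List ℝ) (L : List α) : List (Finset α) → List (Cell α)
  | [] => .num 1 :: records x L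
  | A :: ans => .num #A :: (A.toList.map .elem ++ workMem x L ans)

theorem elemsAt_positions [DecidableEq α] {mem : List (Cell α)} {S : Finset α}
    (h : ∀ a ∈ S, Cell.elem a ∈ mem) : elemsAt mem (positions mem S) = S := by
  ext a
  simp only [elemsAt, stored, positions, List.mem_toFinset, List.mem_filterMap, List.mem_filter,
    List.mem_range, decide_eq_true_eq]
  constructor
  · rintro ⟨c, ⟨i, ⟨-, b, hb, hi⟩, hc⟩, hca⟩
    rw [hi, Option.some.injEq] at hc
    subst hc
    simp only [Cell.elem?, Option.some.injEq] at hca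
    exact hca ▸ hb
  · intro ha
    obtain ⟨i, hi, hia⟩ := List.getElem_of_mem (h a ha)
    have h' : mem[i]? = some (.elem a) := by rw [List.getElem?_eq_getElem hi, hia]
    exact ⟨_, ⟨i, ⟨hi, a, ha, h'⟩, h'⟩, rfl⟩

theorem filterMap_refTo {mem mem' : List (Cell α)}
    (h : ∀ c ∈ mem', c.num? = none → c ∈ mem) :
    (mem'.map (refTo mem)).filterMap (Ref.eval mem) = mem' := by
  classical
  induction mem' with
  | nil => rfl
  | cons c m ih =>
    have hc : Ref.eval mem (refTo mem c) = some c := by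
      cases c with
      | num k => rfl
      | elem a =>
        simp only [refTo, Ref.eval]
        convert List.getElem?_idxOf (h _ List.mem_cons_self rfl)
      | val v =>
        simp only [refTo, Ref.eval]
        convert List.getElem?_idxOf (h _ List.mem_cons_self rfl)
    rw [List.map_cons, List.filterMap_cons_some hc, ih fun c hc => h c (List.mem_cons_of_mem _ hc)]

theorem groups_vals_append (vs : List ℝ) (m : List (Cell α)) :
    groups (vs.map .val ++ m) = groups m := by
  induction vs with
  | nil => rfl
  | cons v vs ih => exact ih

theorem groups_elems_append (l : List α) (m : List (Cell α)) :
    groups (l.map .elem ++ m) = (groups m).modifyHead (l ++ ·) := by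
  induction l with
  | nil => cases h : groups m <;> simp [h]
  | cons a l ih =>
    simp only [List.map_cons, List.cons_append, groups, ih]
    cases groups m <;> rfl

theorem groups_records (x : α → List ℝ) (L : List α) : groups (records x L) = [L] := by
  induction L with
  | nil => rfl
  | cons a L ih =>
    rw [records] at ih ⊢
    rw [List.flatMap_cons, List.cons_append, groups, groups_vals_append, ih]
    rfl

theorem groups_workMem (x : α → List ℝ) (L : List α) (ans : List (Finset α)) :
    groups (workMem x L ans) = [] :: (ans.map Finset.toList ++ [L]) := by
  induction ans with
  | nil => rw [workMem, groups, groups_records]; rfl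
  | cons A ans ih =>
    rw [workMem, groups, groups_elems_append, ih]
    simp

theorem leadingVals_append (vs : List ℝ) (m : List (Cell α)) :
    leadingVals (vs.map .val ++ m) = vs ++ leadingVals m := by
  induction vs with
  | nil => rfl
  | cons v vs ih => simp only [List.map_cons, List.cons_append, leadingVals, ih]

theorem leadingVals_workMem (x : α → List ℝ) (L : List α) (ans : List (Finset α)) :
    leadingVals (workMem x L ans) = [] := by
  cases ans <;> rfl

theorem filterMap_num?_records (x : α → List ℝ) (L : List α) :
    (records x L).filterMap Cell.num? = [] := by
  simp only [records, List.filterMap_eq_nil_iff, List.mem_flatMap, List.mem_cons, List.mem_map]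
  rintro c ⟨a, -, rfl | ⟨v, -, rfl⟩⟩ <;> rfl

theorem lastNum_append (m : List (Cell α)) (k : ℕ) (x : α → List ℝ) (L : List α) :
    lastNum (m ++ .num k :: records x L) = some k := by
  simp [lastNum, Cell.num?, filterMap_num?_records]

theorem exists_workMem_eq (x : α → List ℝ) (L : List α) (ans : List (Finset α)) :
    ∃ m, workMem x L ans = m ++ .num 1 :: records x L := by
  induction ans with
  | nil => exact ⟨[], rfl⟩
  | cons A ans ih =>
    obtain ⟨m, hm⟩ := ih
    exact ⟨.num #A :: (A.toList.map .elem ++ m), by simp [workMem, hm]⟩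

theorem suffixWeight_tails [DecidableEq α] (f : Finset α → ℝ) (L : List α) :
    suffixWeight L (L.tails.map fun l => f l.toFinset) = incWeight f L := by
  induction L with
  | nil => funext x; simp [suffixWeight, incWeight]
  | cons a L ih =>
    funext x
    cases L with
    | nil => simp [suffixWeight, incWeight]
    | cons b L =>
      rw [incWeight, ← ih]
      simp [suffixWeight]

theorem valAfter_vals_append [DecidableEq α] (vs : List ℝ) (m : List (Cell α)) :
    valAfter (vs.map .val ++ m) = valAfter m := by
  induction vs with
  | nil => rfl
  | cons v vs ih => rw [← ih]; funext y; simp [valAfter]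

theorem valAfter_num [DecidableEq α] (k : ℕ) (m : List (Cell α)) :
    valAfter (.num k :: m) = valAfter m := by
  funext y; simp [valAfter]

/-- Elements in an oracle answer are followed by an element or a number, never by a real, so they
are not mistaken for weight records. -/
theorem valAfter_elems_append [DecidableEq α] (l : List α) (k : ℕ) (m : List (Cell α)) :
    valAfter (l.map .elem ++ .num k :: m) = valAfter m := by
  induction l with
  | nil => exact valAfter_num k m
  | cons a l ih =>
    funext y
    rw [← ih]
    cases l <;> simp [valAfter]

theorem valAfter_workMem [DecidableEq α] (w : α → ℝ) (L : List α) (ans : List (Finset α)) (y : α) :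
    valAfter (workMem (fun a => [w a]) L ans) y = if y ∈ L then w y else 0 := by
  have hrec : valAfter (records (fun a => [w a]) L) y = if y ∈ L then w y else 0 := by
    induction L with
    | nil => simp [records, valAfter]
    | cons a L ih =>
      have h : records (fun a => [w a]) (a :: L) =
        .elem a :: .val (w a) :: records (fun a => [w a]) L := rfl
      rw [h, valAfter, ih]
      by_cases hy : y = a <;> simp [hy]
  rw [← hrec]
  obtain _ | ⟨A, ans⟩ := ans
  · rw [workMem, valAfter_num]
  · rw [workMem, valAfter_num]
    induction ans generalizing A with
    | nil => rw [workMem, valAfter_elems_append]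
    | cons B ans ih => rw [workMem, valAfter_elems_append, ih]

end decoding

/-! ### Execution of the search and its space -/

section machine

variable {α : Type} {q : ℕ}

theorem memBits_cons (cost : α → ℕ) (c : Cell α) (m : List (Cell α)) :
    memBits cost (c :: m) = c.bits cost + memBits cost m := by
  simp [memBits]

theorem memBits_append (cost : α → ℕ) (m m' : List (Cell α)) :
    memBits cost (m ++ m') = memBits cost m + memBits cost m' := by
  simp [memBits]

theorem memBits_vals (cost : α → ℕ) (vs : List ℝ) :
    memBits cost (vs.map .val) = vs.length := by
  simp [memBits, Function.comp_def, Cell.bits]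

theorem elem_mem_records (x : α → List ℝ) {L : List α} {a : α} (h : a ∈ L) :
    .elem a ∈ records x L :=
  List.mem_flatMap.2 ⟨a, h, List.mem_cons_self⟩

theorem records_subset (x : α → List ℝ) {L L' : List α} (h : L ⊆ L') :
    records x L ⊆ records x L' := fun _ hc =>
  have ⟨a, ha, hc⟩ := List.mem_flatMap.1 hc
  List.mem_flatMap.2 ⟨a, h ha, hc⟩

theorem num?_of_mem_records {x : α → List ℝ} {L : List α} {c : Cell α} (h : c ∈ records x L) :
    c.num? = none := by
  obtain ⟨a, -, h⟩ := List.mem_flatMap.1 h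
  rcases List.mem_cons.1 h with rfl | h
  · rfl
  · obtain ⟨v, -, rfl⟩ := List.mem_map.1 h
    rfl

theorem records_subset_workMem (x : α → List ℝ) (L : List α) (ans : List (Finset α)) :
    records x L ⊆ workMem x L ans := by
  obtain ⟨m, hm⟩ := exists_workMem_eq x L ans
  rw [hm]
  exact fun c hc => List.mem_append_right _ (List.mem_cons_of_mem _ hc)

/-- The answers of the first `n` independence oracles. -/
def firstAnswers (O : Oracles α q) (S : Finset α) (n : ℕ) : List (Finset α) :=
  ((List.range n).map fun i => if h : i < q then O.circuit ⟨i, h⟩ S else ∅).reverse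

theorem firstAnswers_succ (O : Oracles α q) (S : Finset α) {n : ℕ} (h : n < q) :
    firstAnswers O S (n + 1) = O.circuit ⟨n, h⟩ S :: firstAnswers O S n := by
  simp [firstAnswers, List.range_succ, h]

theorem memBits_workMem (cost : α → ℕ) (x : α → List ℝ) (L : List α) (ans : List (Finset α)) :
    memBits cost (workMem x L ans) = memBits cost (records x L) + 2 +
      (ans.map fun A => Nat.size #A + 1 + ∑ a ∈ A, cost a).sum := by
  induction ans with
  | nil =>
    rw [workMem, memBits_cons]
    simp [Cell.bits]
    omega
  | cons A ans ih =>
    rw [workMem, memBits_cons, memBits_append, ih, List.map_cons, List.sum_cons]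
    have h : memBits cost (A.toList.map .elem) = ∑ a ∈ A, cost a := by
      rw [memBits, List.map_map, ← Finset.sum_map_toList]
      rfl
    rw [h, Cell.bits]
    omega

variable [DecidableEq α]

/-- The instruction that turns the memory `mem` into `mem'`. -/
noncomputable def rewriteTo (mem mem' : List (Cell α)) : Instr q :=
  .rewrite (mem'.map (refTo mem))

/-- The streaming algorithm that keeps a list of elements. If the list is `L` when `e` arrives, then
it queries the independence oracles for the set of the elements of `e :: L`, the value oracle for
all suffixes of `e :: L`, and proceeds to `D ans e L w`, where `ans` are the answers of the
independence oracles and `w` is obtained from the memory by `wt`. The numbers stored together with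
an element are recovered from the memory by `ext`. -/
noncomputable def searchAlgo (D : (Fin q → Finset α) → α → List α → (α → ℝ) → List α)
    (ext : List (Cell α) → α → List ℝ) (wt : List (Cell α) → List α → α → ℝ) : Algo α q
  -- An element in front signals an arrival. All old numbers are dropped and the mark `1`, for work
  -- in progress, is put in front.
  | .elem a :: m => rewriteTo (.elem a :: m)
      (.num 1 :: (Cell.elem a :: m).filter fun c => c.num?.isNone)
  | mem =>
    -- The mark sits directly before the records and all answers are put in front of it, so it
    -- remains the last number.
    if lastNum mem = some 1 then
      let gs := (groups mem).reverse
      let els := gs.headD []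
      -- Two groups are not answers: the records, and the empty group before the first number. The
      -- rest counts the independence queries made so far.
      if h : gs.length - 2 < q then .circuit ⟨gs.length - 2, h⟩ (positions mem els.toFinset)
      -- The leading reals count the value queries. The suffixes are asked for from the empty one
      -- upwards, so there is one query more than there are elements.
      else if (leadingVals mem).length ≤ els.length then
        .value (positions mem (els.drop (els.length - (leadingVals mem).length)).toFinset)
      else match els with
        | [] => .next
        | e :: L => rewriteTo mem (.num 0 :: records (ext mem)
            (D (fun i => (gs.getD (i + 1) []).toFinset) e L (wt mem els)))
    else match mem with
      -- Two numbers in front arise from the end mark of a pass, which is discarded.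
      | .num _ :: .num j :: m => rewriteTo mem (.num j :: m)
      | _ => .next

theorem execInstr_rewriteTo (O : Oracles α q) {mem mem' : List (Cell α)}
    (h : ∀ c ∈ mem', c.num? = none → c ∈ mem) :
    execInstr O mem (rewriteTo mem mem') = mem' := filterMap_refTo h

/-- The memory in which the solution `L` waits for the next stream item. -/
def IsIdle (x : α → List ℝ) (L : List α) (mem : List (Cell α)) : Prop :=
  mem = .num 0 :: records x L ∨ mem = [] ∧ L = []

theorem stored_records (x : α → List ℝ) (L : List α) : stored (records x L) = L.toFinset := by
  ext a
  simp only [stored, records, List.mem_toFinset, List.mem_filterMap, List.mem_flatMap,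
    List.mem_cons, List.mem_map]
  constructor
  · rintro ⟨c, ⟨b, hb, rfl | ⟨v, -, rfl⟩⟩, hc⟩
    · simp only [Cell.elem?, Option.some.injEq] at hc
      exact hc ▸ hb
    · simp [Cell.elem?] at hc
  · exact fun ha => ⟨.elem a, ⟨a, ha, Or.inl rfl⟩, rfl⟩

theorem stored_of_isIdle {x : α → List ℝ} {L : List α} {mem : List (Cell α)}
    (h : IsIdle x L mem) : stored mem = L.toFinset := by
  obtain rfl | ⟨rfl, rfl⟩ := h
  · exact stored_records x L
  · rfl

/-- The values of the last `j` suffixes of `L`. -/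
def lastValues (O : Oracles α q) (L : List α) (j : ℕ) : List ℝ :=
  ((L.tails.map fun l => O.value l.toFinset)).drop (L.length + 1 - j)

theorem lastValues_succ (O : Oracles α q) (L : List α) {j : ℕ} (h : j ≤ L.length) :
    lastValues O L (j + 1) = O.value (L.drop (L.length - j)).toFinset :: lastValues O L j := by
  have h1 : L.length + 1 - (j + 1) = L.length - j := by omega
  have h2 : L.length + 1 - j = L.length - j + 1 := by omega
  rw [lastValues, lastValues, h1, h2, List.drop_eq_getElem_cons (by simp)]
  simp

theorem length_lastValues (O : Oracles α q) (L : List α) {j : ℕ} (h : j ≤ L.length + 1) :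
    (lastValues O L j).length = j := by
  simp [lastValues]; omega

/-- The memory in the course of the queries. -/
noncomputable def queryMem (x : α → List ℝ) (O : Oracles α q) (L : List α) (n j : ℕ) :
    List (Cell α) :=
  (lastValues O L j).map .val ++ workMem x L (firstAnswers O L.toFinset n)

variable {x : α → List ℝ} {O : Oracles α q} {L : List α} {n j : ℕ}
  {D : (Fin q → Finset α) → α → List α → (α → ℝ) → List α}
  {ext : List (Cell α) → α → List ℝ} {wt : List (Cell α) → List α → α → ℝ}
  {cost : α → ℕ} {s : ℕ}

theorem groups_queryMem (x : α → List ℝ) (O : Oracles α q) (L : List α) (n j : ℕ) :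
    (groups (queryMem x O L n j)).reverse =
      L :: ((List.range n).map fun i =>
        (if h : i < q then O.circuit ⟨i, h⟩ L.toFinset else ∅).toList) ++ [[]] := by
  rw [queryMem, groups_vals_append, groups_workMem, firstAnswers]
  simp [Function.comp_def]

theorem lastNum_queryMem (x : α → List ℝ) (O : Oracles α q) (L : List α) (n j : ℕ) :
    lastNum (queryMem x O L n j) = some 1 := by
  obtain ⟨m, hm⟩ := exists_workMem_eq x L (firstAnswers O L.toFinset n)
  rw [queryMem, hm, ← List.append_assoc]
  exact lastNum_append _ _ _ _

theorem leadingVals_queryMem (x : α → List ℝ) (O : Oracles α q) (L : List α) (n j : ℕ) :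
    leadingVals (queryMem x O L n j) = lastValues O L j := by
  rw [queryMem, leadingVals_append, leadingVals_workMem, List.append_nil]

theorem mem_queryMem (x : α → List ℝ) (O : Oracles α q) (L : List α) (n j : ℕ) :
    records x L ⊆ queryMem x O L n j := fun _ hc =>
  List.mem_append_right _ (records_subset_workMem _ _ _ hc)

/-- Memory in the course of queries cannot be confused with an arrival, since every answer starts
with a number or a real. -/
theorem queryMem_ne_elem (x : α → List ℝ) (O : Oracles α q) (L : List α) (n j : ℕ) (a : α)
    (m : List (Cell α)) : queryMem x O L n j ≠ .elem a :: m := by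
  rw [queryMem]
  cases lastValues O L j with
  | nil => cases firstAnswers O L.toFinset n <;> simp [workMem]
  | cons v vs => simp

theorem searchAlgo_queryMem (n j : ℕ) :
    searchAlgo D ext wt (queryMem x O L n j) =
      if h : n < q then .circuit ⟨n, h⟩ (positions (queryMem x O L n j) L.toFinset)
      else if (lastValues O L j).length ≤ L.length then
        .value (positions (queryMem x O L n j)
          (L.drop (L.length - (lastValues O L j).length)).toFinset)
      else match L with
        | [] => .next
        | e :: L' => rewriteTo (queryMem x O L n j) (.num 0 :: records (ext (queryMem x O L n j))
            (D (fun i => ((groups (queryMem x O L n j)).reverse.getD (i + 1) []).toFinset) e L'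
              (wt (queryMem x O L n j) L))) := by
  rw [searchAlgo.eq_def]
  split
  · rename_i a m h
    exact absurd h (queryMem_ne_elem x O L n j a m)
  · rw [if_pos (lastNum_queryMem x O L n j)]
    simp only [leadingVals_queryMem]
    have h1 : (groups (queryMem x O L n j)).reverse.headD [] = L := by
      rw [groups_queryMem]; rfl
    have h2 : (groups (queryMem x O L n j)).reverse.length - 2 = n := by
      rw [groups_queryMem]; simp
    simp only [h1, h2]

theorem searchAlgo_idle {mem : List (Cell α)} (h : IsIdle x L mem) :
    searchAlgo D ext wt mem = .next := by
  obtain rfl | ⟨rfl, rfl⟩ := h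
  · have h1 : lastNum (.num 0 :: records x L) = some 0 := lastNum_append [] 0 x L
    cases L with
    | nil => simp [searchAlgo, records, lastNum, Cell.num?]
    | cons a L =>
      rw [records, List.flatMap_cons, List.cons_append] at h1 ⊢
      simp [searchAlgo, h1]
  · simp [searchAlgo, lastNum]

/-- The processing of a mark for the end of a pass. -/
theorem handles_mark {mem : List (Cell α)} (h : IsIdle x L mem)
    (hs : memBits cost (.num 0 :: .num 0 :: records x L) ≤ s) :
    ∃ mem', IsIdle x L mem' ∧
      Handles (searchAlgo D ext wt) O cost s ([.num 0] ++ mem) mem' := by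
  obtain rfl | ⟨rfl, rfl⟩ := h
  · refine ⟨.num 0 :: records x L, Or.inl rfl, ?_⟩
    have h1 : lastNum (.num 0 :: .num 0 :: records x L) = some 0 := lastNum_append [.num 0] 0 x L
    have h2 : searchAlgo D ext wt (.num 0 :: .num 0 :: records x L) =
        rewriteTo (.num 0 :: .num 0 :: records x L) (.num 0 :: records x L) := by
      simp [searchAlgo, h1]
    refine .step _ _ (by rw [List.singleton_append, h2]; simp [rewriteTo]) hs ?_
    rw [List.singleton_append, h2, execInstr_rewriteTo _ fun c hc _ => List.mem_cons_of_mem _ hc]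
    refine .done _ (searchAlgo_idle (Or.inl rfl)) ?_
    rw [memBits_cons] at hs
    omega
  -- On empty memory the end mark itself yields the idle form of the empty solution.
  · refine ⟨.num 0 :: records x [], Or.inl rfl, .done _
      (searchAlgo_idle (x := x) (L := []) (Or.inl rfl)) ?_⟩
    rw [memBits_cons] at hs
    exact (Nat.le_add_left _ _).trans hs

theorem memBits_queryMem_le (hn : n ≤ q) (hj : j ≤ L.length + 1) :
    memBits cost (queryMem x O L n j) ≤ memBits cost (records x L) + 2 + (L.length + 1) +
      ∑ i, (Nat.size #(O.circuit i L.toFinset) + 1 + ∑ a ∈ O.circuit i L.toFinset, cost a) := by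
  have key : ∀ n, n ≤ q → ((firstAnswers O L.toFinset n).map
      fun A => Nat.size #A + 1 + ∑ a ∈ A, cost a).sum ≤
      ∑ i, (Nat.size #(O.circuit i L.toFinset) + 1 + ∑ a ∈ O.circuit i L.toFinset, cost a) := by
    intro n hn
    have h1 : ((firstAnswers O L.toFinset n).map
        fun A => Nat.size #A + 1 + ∑ a ∈ A, cost a).sum =
        ∑ i : Fin n, (Nat.size #(O.circuit (i.castLE hn) L.toFinset) + 1 +
          ∑ a ∈ O.circuit (i.castLE hn) L.toFinset, cost a) := by
      induction n with
      | zero => simp [firstAnswers]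
      | succ n ih =>
        rw [firstAnswers_succ _ _ hn, List.map_cons, List.sum_cons, ih (Nat.le_of_succ_le hn),
          Fin.sum_univ_castSucc, add_comm]
        rfl
    rw [h1]
    refine (Finset.sum_map univ (Fin.castLEEmb hn) fun i => Nat.size #(O.circuit i L.toFinset) +
      1 + ∑ a ∈ O.circuit i L.toFinset, cost a).ge.trans ?_
    exact sum_le_sum_of_subset (subset_univ _)
  have h2 := key n hn
  rw [queryMem, memBits_append, memBits_vals, memBits_workMem, length_lastValues _ _ hj]
  omega

variable {e : α}

/-- The processing of a stream element. -/
theorem handles_elem {L' : List α} {mem : List (Cell α)} (h : IsIdle x L mem)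
    (hD : ∀ ans w, D ans e L w ⊆ e :: L)
    (hext : ∀ a ∈ e :: L, ext (queryMem x O (e :: L) q (L.length + 2)) a = x a)
    (hL' : L' = D (fun i => O.circuit i (e :: L).toFinset) e L
      (wt (queryMem x O (e :: L) q (L.length + 2)) (e :: L)))
    (hs : memBits cost (records x (e :: L)) + 2 + (L.length + 2) +
      ∑ i, (Nat.size #(O.circuit i (e :: L).toFinset) + 1 +
        ∑ a ∈ O.circuit i (e :: L).toFinset, cost a) ≤ s)
    (hs' : memBits cost (.num 0 :: records x L') ≤ s) :
    Handles (searchAlgo D ext wt) O cost s ((.elem e :: (x e).map .val) ++ mem)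
      (.num 0 :: records x L') := by
  have hbits : ∀ n j, n ≤ q → j ≤ L.length + 2 → memBits cost (queryMem x O (e :: L) n j) ≤ s :=
    fun n j hn hj => (memBits_queryMem_le hn hj).trans hs
  -- The run is traced backwards: the final rewriting, then the value queries, then the independence
  -- queries, by induction on the number still to be made.
  have hfinal : Handles (searchAlgo D ext wt) O cost s (queryMem x O (e :: L) q (L.length + 2))
      (.num 0 :: records x L') := by
    have h1 := searchAlgo_queryMem (D := D) (ext := ext) (wt := wt) (x := x) (O := O)
      (L := e :: L) q (L.length + 2)
    have hlen : (lastValues O (e :: L) (L.length + 2)).length = L.length + 2 :=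
      length_lastValues _ _ le_rfl
    rw [dif_neg (lt_irrefl q), hlen, if_neg (by simp)] at h1
    have h2 : (fun i : Fin q => ((groups (queryMem x O (e :: L) q (L.length + 2))).reverse.getD
        (i + 1) []).toFinset) = fun i => O.circuit i (e :: L).toFinset := by
      funext i
      rw [groups_queryMem, List.cons_append, List.getD_cons_succ,
        List.getD_append _ _ _ _ (by simp),
        List.getD_eq_getElem _ _ (by simp)]
      simp
    have hLsub : L' ⊆ e :: L := hL' ▸ hD _ _
    have h3 : records (ext (queryMem x O (e :: L) q (L.length + 2))) L' = records x L' :=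
      List.flatMap_congr fun a ha => by rw [hext a (hLsub ha)]
    dsimp only at h1
    rw [h2, ← hL', h3] at h1
    refine .step _ _ (by rw [h1]; simp [rewriteTo]) (hbits _ _ le_rfl le_rfl) ?_
    rw [h1, execInstr_rewriteTo]
    · exact .done _ (searchAlgo_idle (Or.inl rfl)) hs'
    · intro c hc hcn
      rcases List.mem_cons.1 hc with rfl | hc
      · simp [Cell.num?] at hcn
      · exact mem_queryMem _ _ _ _ _ (records_subset x hLsub hc)
  have hvals : ∀ k j, j + k = L.length + 2 → Handles (searchAlgo D ext wt) O cost s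
      (queryMem x O (e :: L) q j) (.num 0 :: records x L') := by
    intro k
    induction k with
    | zero => intro j hj; rw [add_zero] at hj; exact hj ▸ hfinal
    | succ k ih =>
      intro j hj
      have hj' : j ≤ (e :: L).length := by rw [List.length_cons]; omega
      have h1 := searchAlgo_queryMem (D := D) (ext := ext) (wt := wt) (x := x) (O := O)
        (L := e :: L) q j
      rw [dif_neg (lt_irrefl q), length_lastValues _ _ (hj'.trans (Nat.le_succ _)),
        if_pos hj'] at h1
      refine .step _ _ (by rw [h1]; simp) (hbits _ _ le_rfl (by omega)) ?_
      rw [h1, execInstr, elemsAt_positions fun a ha => mem_queryMem _ _ _ _ _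
        (elem_mem_records x (List.drop_subset _ _ (List.mem_toFinset.1 ha)))]
      have h2 := ih (j + 1) (by omega)
      rw [queryMem, lastValues_succ _ _ hj'] at h2
      exact h2
  have hcirc : ∀ k n, n + k = q → Handles (searchAlgo D ext wt) O cost s
      (queryMem x O (e :: L) n 0) (.num 0 :: records x L') := by
    intro k
    induction k with
    | zero => intro n hn; rw [add_zero] at hn; exact hn ▸ hvals (L.length + 2) 0 (by omega)
    | succ k ih =>
      intro n hn
      have hn' : n < q := by omega
      have h1 := searchAlgo_queryMem (D := D) (ext := ext) (wt := wt) (x := x) (O := O)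
        (L := e :: L) n 0
      rw [dif_pos hn'] at h1
      have h0 : lastValues O (e :: L) 0 = [] := by simp [lastValues]
      refine .step _ _ (by rw [h1]; simp) (hbits _ _ hn'.le (by omega)) ?_
      rw [h1, execInstr, elemsAt_positions fun a ha => mem_queryMem _ _ _ _ _
        (elem_mem_records x (List.mem_toFinset.1 ha))]
      have h2 := ih (n + 1) (by omega)
      rw [queryMem, firstAnswers_succ _ _ hn', h0] at h2
      rw [queryMem, h0]
      exact h2
  have hstart := hcirc q 0 (zero_add q)
  have h0 : queryMem x O (e :: L) 0 0 = .num 1 :: records x (e :: L) := by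
    simp [queryMem, lastValues, firstAnswers, workMem]
  rw [h0] at hstart
  have hfilt : ((.elem e :: (x e).map .val) ++ mem : List (Cell α)).filter
      (fun c => c.num?.isNone) =
      records x (e :: L) := by
    have h1 : ∀ L, (records x L).filter (fun c => c.num?.isNone) = records x L := fun L =>
      List.filter_eq_self.2 fun c hc => by rw [num?_of_mem_records hc]; rfl
    have h2 : ((.elem e :: (x e).map .val) : List (Cell α)) = records x [e] := by simp [records]
    rw [List.filter_append, h2, h1]
    obtain rfl | ⟨rfl, rfl⟩ := h
    · rw [List.filter_cons_of_neg (by simp [Cell.num?]), h1, records, records, records,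
        ← List.flatMap_append]
      rfl
    · simp
  have hA : searchAlgo D ext wt ((.elem e :: (x e).map .val) ++ mem) =
      rewriteTo ((.elem e :: (x e).map .val) ++ mem) (.num 1 :: records x (e :: L)) := by
    rw [← hfilt]
    rfl
  refine .step _ _ (by rw [hA]; simp [rewriteTo]) ?_ ?_
  · have h1 : memBits cost ((.elem e :: (x e).map .val) ++ mem) ≤
        memBits cost (.num 1 :: records x (e :: L)) := by
      have h2 : records x (e :: L) = (.elem e :: (x e).map .val) ++ records x L := rfl
      rw [h2, memBits_cons _ (.num 1), memBits_append, memBits_append]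
      obtain rfl | ⟨rfl, rfl⟩ := h
      · rw [memBits_cons _ (.num 0)]
        simp [Cell.bits]
        omega
      · simp [records, memBits, Cell.bits]
    exact h1.trans (h0 ▸ hbits 0 0 (Nat.zero_le _) (Nat.zero_le _))
  · rw [hA, execInstr_rewriteTo]
    · exact hstart
    · intro c hc hcn
      rcases List.mem_cons.1 hc with rfl | hc
      · simp [Cell.num?] at hcn
      · rw [← hfilt] at hc
        exact List.mem_of_mem_filter hc

theorem Reads.append {A : Algo α q} {i₁ i₂ : List (List (Cell α))} {m₁ m₂ m₃ : List (Cell α)}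
    (h₁ : Reads A O cost s i₁ m₁ m₂) (h₂ : Reads A O cost s i₂ m₂ m₃) :
    Reads A O cost s (i₁ ++ i₂) m₁ m₃ := by
  induction h₁ with
  | nil => exact h₂
  | cons item items mem mem₁ mem₂ h _ ih => exact .cons _ _ _ _ _ h (ih h₂)

/-- The outcome of `k` passes is obtained by iterating the function `step`, provided that it
describes the processing of single elements. -/
theorem outputs_of_step {A : Algo α q} {σ : List α} {P : List α → Prop} {step : List α → α → List α}
    (h0 : P []) (hP : ∀ L, P L → ∀ e ∈ σ, P (step L e))
    (helem : ∀ L, P L → ∀ e ∈ σ, ∀ mem, IsIdle x L mem → ∃ mem', IsIdle x (step L e) mem' ∧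
      Handles A O cost s ((.elem e :: (x e).map .val) ++ mem) mem')
    (hmark : ∀ L, P L → ∀ mem, IsIdle x L mem → ∃ mem', IsIdle x L mem' ∧
      Handles A O cost s ([.num 0] ++ mem) mem') (k : ℕ) :
    Outputs A O cost s k (σ.map (fun e => .elem e :: (x e).map .val) ++ [[.num 0]])
      ((fun L => σ.foldl step L)^[k] []).toFinset := by
  have hfold : ∀ τ, τ ⊆ σ → ∀ L, P L → ∀ mem, IsIdle x L mem → P (τ.foldl step L) ∧
      ∃ mem', IsIdle x (τ.foldl step L) mem' ∧
        Reads A O cost s (τ.map fun e => .elem e :: (x e).map .val) mem mem' := by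
    intro τ
    induction τ with
    | nil => exact fun _ L hL mem hm => ⟨hL, mem, hm, .nil _⟩
    | cons e τ ih =>
      intro hτ L hL mem hm
      have he := hτ List.mem_cons_self
      obtain ⟨m₁, hm₁, hh⟩ := helem L hL e he mem hm
      obtain ⟨h1, m₂, hm₂, hr⟩ := ih (fun a ha => hτ (List.mem_cons_of_mem _ ha)) _
        (hP L hL e he) m₁ hm₁
      exact ⟨h1, m₂, hm₂, .cons _ _ _ _ _ hh hr⟩
  have hpass : ∀ L, P L → ∀ mem, IsIdle x L mem → P (σ.foldl step L) ∧
      ∃ mem', IsIdle x (σ.foldl step L) mem' ∧ Reads A O cost s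
        (σ.map (fun e => .elem e :: (x e).map .val) ++ [[.num 0]]) mem mem' := by
    intro L hL mem hm
    obtain ⟨h1, m₁, hm₁, hr⟩ := hfold σ (List.Subset.refl _) L hL mem hm
    obtain ⟨m₂, hm₂, hh⟩ := hmark _ h1 m₁ hm₁
    exact ⟨h1, m₂, hm₂, hr.append (.cons _ _ _ _ _ hh (.nil _))⟩
  have hiter : ∀ k L, P L → ∀ mem, IsIdle x L mem →
      ∃ mem', IsIdle x ((fun L => σ.foldl step L)^[k] L) mem' ∧ Reads A O cost s
        (List.replicate k (σ.map (fun e => .elem e :: (x e).map .val) ++ [[.num 0]])).flatten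
          mem mem' := by
    intro k
    induction k with
    | zero => exact fun L _ mem hm => ⟨mem, hm, .nil _⟩
    | succ k ih =>
      intro L hL mem hm
      obtain ⟨h1, m₁, hm₁, hr₁⟩ := hpass L hL mem hm
      obtain ⟨m₂, hm₂, hr₂⟩ := ih _ h1 m₁ hm₁
      refine ⟨m₂, hm₂, ?_⟩
      rw [List.replicate_succ, List.flatten_cons]
      exact hr₁.append hr₂
  obtain ⟨mem, hm, hr⟩ := hiter k [] h0 [] (Or.inr ⟨rfl, rfl⟩)
  exact ⟨mem, hr, stored_of_isIdle hm⟩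

end machine

/-! ## Approximation guarantees of the streaming algorithms -/

/-- A bound on the number of bits needed to handle the element `e` with the solution `L`. -/
structure FitsIn {α : Type} [DecidableEq α] {q : ℕ} (circuit : Fin q → Finset α → Finset α)
    (cost : α → ℕ) (s : ℕ) (L : List α) (σ : List α) : Prop where
  idle : (L.map (cost · + 1)).sum + 2 ≤ s
  query : ∀ e ∈ σ, ((e :: L).map (cost · + 1)).sum + L.length + 4 +
    ∑ i, (Nat.size #(circuit i (e :: L).toFinset) + 1 + ∑ a ∈ circuit i (e :: L).toFinset, cost a)
      ≤ s

/-- After `k` passes, in each of which the gain is large compared with the weight `κ` of the removed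
elements or the bound `b` is good, the value has been approximated within the factor `ρ`. -/
def PassesSuffice (b : ℝ → ℝ → ℝ) (r : ℝ) (k : ℕ) (ρ : ℝ) : Prop :=
  ∀ (X : ℕ → ℝ) (F : ℝ), X 0 = 0 → (∀ j, 0 ≤ X j) →
    (∀ j, ∃ κ, 0 ≤ κ ∧ (r - 1) * κ ≤ X (j + 1) - X j ∧ F ≤ b (X (j + 1)) κ) → F ≤ ρ * X k

section algorithms

variable {α ι : Type} [DecidableEq α] [DecidableEq ι] [Fintype ι] {p q : ℕ}

theorem memBits_records_le {α : Type} {x : α → List ℝ} (hx : ∀ a, (x a).length ≤ 1) (cost : α → ℕ)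
    (L : List α) : memBits cost (records x L) ≤ (L.map (cost · + 1)).sum := by
  induction L with
  | nil => exact Nat.zero_le _
  | cons a L ih =>
    have h : records x (a :: L) = .elem a :: ((x a).map .val ++ records x L) := rfl
    rw [h, memBits_cons, memBits_append, memBits_vals, List.map_cons, List.sum_cons, Cell.bits]
    have := hx a
    omega

/-- Local search with threshold `r`, with conflict sets determined by `conf`. -/
noncomputable def localSearch (r : ℝ)
    (conf : (Fin q → Finset α) → α → List α → (α → ℝ) → Option (Finset α))
    (ext : List (Cell α) → α → List ℝ) (wt : List (Cell α) → List α → α → ℝ) : Algo α q :=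
  searchAlgo (fun ans e L w => exchangeStep r (conf ans e L w) e L w) ext wt

variable {Φ : ClosureSystem α ι p} {ind : Finset α → Prop}
  {conf : (Fin q → Finset α) → α → List α → (α → ℝ) → Option (Finset α)} {σ : List α}
  {f : Finset α → ℝ} {r ρ : ℝ} {O : Oracles α q} {cost : α → ℕ} {s k : ℕ}

/-- The local search finds an approximate solution if the algorithm computes the correct weights. -/
theorem localSearch_outputs {x : α → List ℝ} {ext : List (Cell α) → α → List ℝ}
    {wt : List (Cell α) → List α → α → ℝ} (hf : IsSubmodularOn σ.toFinset f) (hr : 1 ≤ r)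
    (hc : Φ.IsRule σ.toFinset ind fun L e w => conf (fun i => O.circuit i (e :: L).toFinset) e L w)
    (h0 : ind ∅) (hx : ∀ a, (x a).length ≤ 1)
    (hext : ∀ L e, ∀ a ∈ e :: L, ext (queryMem x O (e :: L) q (L.length + 2)) a = x a)
    (hwt : ∀ L e, (e :: L).Nodup →
      wt (queryMem x O (e :: L) q (L.length + 2)) (e :: L) = incWeight f (e :: L))
    (hs : ∀ L, IsSolution σ.toFinset ind L → FitsIn O.circuit cost s L σ)
    {b : ℝ → ℝ → ℝ} (hb : PassesSuffice b r k ρ)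
    (hbound : ∀ J ⊆ σ.toFinset, ∀ v κ, f J ≤ v + κ + r * (p * v + (p - 1) * κ) ∧
      (∀ w : α → ℝ, f = (fun S => ∑ e ∈ S, w e) → f J ≤ r * (p * v + (p - 1) * κ)) →
        f J ≤ b v κ) :
    ∃ I, Outputs (localSearch r conf ext wt) O cost s k
        (σ.map (fun e => .elem e :: (x e).map .val) ++ [[.num 0]]) I ∧
      IsApproxMax σ.toFinset ind f ρ I := by
  set c := fun L e w => conf (fun i => O.circuit i (e :: L).toFinset) e L w with hcdef
  let step := ClosureSystem.searchStep f r c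
  let pass := fun L => σ.foldl step L
  have hsol0 : IsSolution σ.toFinset ind [] := ⟨List.nodup_nil, by simp, by simpa using h0⟩
  have hstep : ∀ L, IsSolution σ.toFinset ind L → ∀ e ∈ σ, IsSolution σ.toFinset ind (step L e) :=
    fun L hL e he => ClosureSystem.isSolution_foldl (σ := [e]) hf hr hc
      (by simpa using he) hL
  have hsol : ∀ j, IsSolution σ.toFinset ind (pass^[j] []) := by
    intro j
    induction j with
    | zero => exact hsol0
    | succ j ih =>
      rw [Function.iterate_succ_apply']
      exact ClosureSystem.isSolution_foldl hf hr hc (fun e he => List.mem_toFinset.2 he) ih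
  refine ⟨(pass^[k] []).toFinset, ?_, (hsol k).subset, (hsol k).indep, fun J hJ hind => ?_⟩
  · refine outputs_of_step hsol0 hstep (fun L hL e he mem hmem => ?_) (fun L hL mem hmem => ?_) k
    · refine ⟨_, Or.inl rfl, handles_elem hmem (fun ans w => exchangeStep_subset _ _ _ _ _)
        (hext L e) ?_ ?_ ?_⟩
      -- If `e ∈ L`, then `e :: L` has a repetition and the decoded weights may be wrong, but the
      -- step does not look at them.
      · by_cases heL : e ∈ L
        · dsimp only [step, ClosureSystem.searchStep]
          rw [exchangeStep_of_mem _ _ _ heL, exchangeStep_of_mem _ _ _ heL]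
        · rw [hwt L e (List.nodup_cons.2 ⟨heL, hL.nodup⟩)]
          rfl
      · have h1 := (hs L hL).query e he
        have h2 := memBits_records_le hx cost (e :: L)
        omega
      · have h1 := (hs _ (hstep L hL e he)).idle
        have h2 := memBits_records_le hx cost (step L e)
        rw [memBits_cons]
        simp only [Cell.bits, Nat.size_zero]
        omega
    · refine handles_mark hmem ?_
      have h1 := (hs L hL).idle
      have h2 := memBits_records_le hx cost L
      rw [memBits_cons, memBits_cons]
      simp only [Cell.bits, Nat.size_zero]
      omega
  · refine hb (fun j => f (pass^[j] []).toFinset) (f J) (by simp [hf.proper])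
      (fun j => hf.nonneg _ (hsol j).subset) fun j => ?_
    obtain ⟨κ, h1, h2, h3⟩ := ClosureSystem.pass_bound hf hr hc (hsol j) rfl
    rw [Function.iterate_succ_apply']
    exact ⟨κ, h1, h2, hbound J hJ _ _ (h3 J hJ hind)⟩

/-- Local search for elements that arrive together with their weights. -/
noncomputable def weightedSearch (r : ℝ)
    (conf : (Fin q → Finset α) → α → List α → (α → ℝ) → Option (Finset α)) : Algo α q :=
  localSearch r conf (fun mem a => [valAfter mem a]) fun mem _ => valAfter mem

/-- Local search for a function given by a value oracle. -/
noncomputable def submodularSearch (r : ℝ)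
    (conf : (Fin q → Finset α) → α → List α → (α → ℝ) → Option (Finset α)) : Algo α q :=
  localSearch r conf (fun _ _ => []) fun mem L => suffixWeight L (leadingVals mem)

theorem weightedSearch_solves {circuit : Fin q → Finset α → Finset α} {w : α → ℝ}
    (hw : ∀ e ∈ σ, 0 ≤ w e) (hr : 1 ≤ r)
    (hc : Φ.IsRule σ.toFinset ind fun L e w => conf (fun i => circuit i (e :: L).toFinset) e L w)
    (h0 : ind ∅) (hs : ∀ L, IsSolution σ.toFinset ind L → FitsIn circuit cost s L σ)
    (hb : PassesSuffice (fun v κ => r * (p * v + (p - 1) * κ)) r k ρ) :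
    SolvesMWIS (weightedSearch r conf) circuit cost s k ρ ind σ w := by
  -- The value oracle is queried here too; its answers stand in front of all elements and are
  -- skipped by `valAfter`.
  have hval : ∀ L n j, valAfter (queryMem (fun a => [w a])
      (⟨fun _ => 0, circuit⟩ : Oracles α q) L n j) = fun a => if a ∈ L then w a else 0 := by
    intro L n j
    funext a
    rw [queryMem, valAfter_vals_append, valAfter_workMem]
  refine localSearch_outputs (O := ⟨fun _ => 0, circuit⟩) (x := fun a => [w a])
    (isSubmodularOn_modular fun e he => hw e (List.mem_toFinset.1 he)) hr hc h0 (fun _ => le_rfl)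
    (fun L e a ha => ?_) (fun L e hL => ?_) hs hb fun J _ v κ h => h.2 w rfl
  · simp only [hval, if_pos ha]
  · rw [hval]
    funext a
    split_ifs with ha
    · rw [incWeight_of_modular w hL ha]
    · rw [incWeight_of_notMem ha]

theorem submodularSearch_solves {circuit : Fin q → Finset α → Finset α}
    (hf : IsSubmodularOn σ.toFinset f) (hr : 1 ≤ r)
    (hc : Φ.IsRule σ.toFinset ind fun L e w => conf (fun i => circuit i (e :: L).toFinset) e L w)
    (h0 : ind ∅) (hs : ∀ L, IsSolution σ.toFinset ind L → FitsIn circuit cost s L σ)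
    (hb : PassesSuffice (fun v κ => v + κ + r * (p * v + (p - 1) * κ)) r k ρ) :
    SolvesMSIS (submodularSearch r conf) circuit cost s k ρ ind σ f := by
  refine localSearch_outputs (O := ⟨f, circuit⟩) (x := fun _ => []) hf hr hc h0
    (fun _ => Nat.zero_le _) (fun _ _ _ _ => rfl) (fun L e _ => ?_) hs hb fun J _ v κ h => h.1
  rw [leadingVals_queryMem, ← suffixWeight_tails]
  simp [lastValues]

end algorithms

/-! ### Thresholds and numbers of passes -/

section passes

variable {p : ℕ}

/-- For `p > 1` this threshold minimizes `r * (p + (p - 1) / (r - 1))`. For `p = 1` it is `1`, which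
leaves `κ` unbounded, but the coefficient of `κ` vanishes. -/
theorem passesSuffice_weighted_one (hp : 1 ≤ p) :
    PassesSuffice (fun v κ => (1 + √((p : ℝ) * (p - 1)) / p) * (p * v + (p - 1) * κ))
      (1 + √((p : ℝ) * (p - 1)) / p) 1 (2 * (p + √((p : ℝ) * (p - 1))) - 1) := by
  intro X F hX0 hX h
  obtain ⟨κ, hκ, h1, h2⟩ := h 0
  rw [hX0, zero_add, sub_zero, add_sub_cancel_left] at h1
  have hp' : (1 : ℝ) ≤ p := by exact_mod_cast hp
  have hp0 : (0 : ℝ) < p := by linarith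
  set q := √((p : ℝ) * (p - 1)) with hq
  have hq0 : 0 ≤ q := Real.sqrt_nonneg _
  have hq2 : q * q = p * (p - 1) := Real.mul_self_sqrt (mul_nonneg hp0.le (by linarith))
  have h3 : (p - 1) * κ ≤ q * X (0 + 1) := by
    have h4 := mul_le_mul_of_nonneg_left h1 hq0
    -- Multiplying by `q` avoids a division by `q`, which is `0` for `p = 1`.
    have h5 : q * (q / p * κ) = (p - 1) * κ := by
      field_simp
      rw [pow_two, hq2]
      ring
    linarith
  have h6 : (1 + q / p) * (p * X (0 + 1) + (p - 1) * κ) ≤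
      (1 + q / p) * (p * X (0 + 1) + q * X (0 + 1)) :=
    mul_le_mul_of_nonneg_left (by linarith) (by positivity)
  have h7 : (1 + q / p) * (p * X (0 + 1) + q * X (0 + 1)) = (2 * (p + q) - 1) * X (0 + 1) := by
    field_simp
    linear_combination X (0 + 1) * hq2
  exact h2.trans (h6.trans h7.le)

/-- With `r = 2`, `κ` is at most the final value, and the coefficients `1 + 2 * p` and `2 * p - 1`
add up to `4 * p`. -/
theorem passesSuffice_submodular_one (hp : 1 ≤ p) :
    PassesSuffice (fun v κ => v + κ + 2 * (p * v + (p - 1) * κ)) 2 1 (4 * p) := by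
  intro X F hX0 hX h
  obtain ⟨κ, hκ, h1, h2⟩ := h 0
  rw [hX0] at h1
  have hp' : (1 : ℝ) ≤ p := by exact_mod_cast hp
  have h3 : (2 * p - 1) * κ ≤ (2 * p - 1) * X (0 + 1) :=
    mul_le_mul_of_nonneg_left (by linarith) (by linarith)
  dsimp only at h2
  rw [zero_add] at h2 h3
  linarith

/-- The number of passes for the approximation parameter `ε`. -/
noncomputable def numPasses (p : ℕ) (ε : ℝ) : ℕ := ⌈2 * (p / ε) + 4 * (p * (p + 1) / ε ^ 2)⌉₊

theorem numPasses_le (hp : 1 ≤ p) {ε : ℝ} (hε : 0 < ε) :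
    (numPasses p ε : ℝ) ≤ 1 + 128 * ((p : ℝ) ^ 4 * (ε⁻¹ ^ 3 * Real.log (p + 1))) := by
  have hp' : (1 : ℝ) ≤ p := by exact_mod_cast hp
  have hlog : 1 / 2 ≤ Real.log (p + 1) := by
    have h1 : Real.log 2 ≤ Real.log (p + 1) := Real.log_le_log two_pos (by linarith)
    linarith [Real.log_two_gt_d9]
  set u := p / ε with hu
  have hu0 : 0 < u := by positivity
  set x := 2 * (p / ε) + 4 * (p * (p + 1) / ε ^ 2) with hx
  have hxu : x ≤ 2 * u + 8 * u ^ 2 := by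
    have : p * (p + 1) / ε ^ 2 ≤ 2 * u ^ 2 := by
      rw [hu, div_pow, ← mul_div_assoc]
      exact div_le_div_of_nonneg_right (by nlinarith) (by positivity)
    rw [hx]
    linarith
  have hrhs : 64 * u ^ 3 ≤ 128 * ((p : ℝ) ^ 4 * (ε⁻¹ ^ 3 * Real.log (p + 1))) := by
    have h1 : (p : ℝ) ^ 4 * (ε⁻¹ ^ 3 * Real.log (p + 1)) = u ^ 3 * (p * Real.log (p + 1)) := by
      rw [hu]; field_simp
    have h2 : 1 / 2 ≤ p * Real.log (p + 1) := by nlinarith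
    rw [h1]
    nlinarith [mul_le_mul_of_nonneg_left h2 (pow_pos hu0 3).le]
  rw [numPasses]
  -- The count is quadratic in `u = p / ε`. If it does not exceed one pass, the summand `1`
  -- suffices; otherwise `u > 1 / 4`, from where on `64 * u ^ 3` dominates `2 * u + 8 * u ^ 2`. The
  -- bound `1 / 2` for the logarithm turns `64` into `128`.
  by_cases hx1 : x ≤ 1
  · have h1 : ⌈x⌉₊ ≤ 1 := Nat.ceil_le.2 (by simpa using hx1)
    have h2 : ((⌈x⌉₊ : ℕ) : ℝ) ≤ 1 := by exact_mod_cast h1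
    have := pow_pos hu0 3
    linarith
  · have hu4 : 1 / 4 < u := by
      by_contra hcon
      nlinarith
    have h1 : x ≤ 64 * u ^ 3 := by
      nlinarith [mul_pos hu0 (sub_pos.2 hu4), mul_pos (mul_pos hu0 hu0) (sub_pos.2 hu4)]
    have h2 : (⌈x⌉₊ : ℝ) < x + 1 := Nat.ceil_lt_add_one (by positivity)
    linarith

/-- Weakening `p - 1` to `p` gives `v` and `κ` a common coefficient `a`, as `le_mul_of_progress`
requires. Half of `ε` is spent on `r`, the other half on convergence. -/
theorem passesSuffice_of_le (hp : 1 ≤ p) {ε a : ℝ} (hε : 0 < ε) (ha0 : 0 < a)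
    (ha : a + ε / 2 ≤ p + 1 + ε) {b : ℝ → ℝ → ℝ} (hb : ∀ v κ, 0 ≤ κ → b v κ ≤ a * v + a * κ) :
    PassesSuffice b (1 + ε / (2 * p)) (numPasses p ε) (a + ε / 2) := by
  intro X F hX0 hX h
  have hp0 : (0 : ℝ) < p := by exact_mod_cast hp
  refine le_mul_of_progress hX0 (hX _) ha0 (γ := ε / (2 * p)) (by positivity) (by linarith) ?_
    fun j => ?_
  · have h1 : 2 * (p / ε) + 4 * (p * (p + 1) / ε ^ 2) ≤ numPasses p ε := Nat.le_ceil _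
    have h2 := mul_le_mul_of_nonneg_right h1
      (show 0 ≤ ε / (2 * p) * (ε / 2) by positivity)
    -- The count is the solution `k` of `k * γ * (ρ - a) = p + 1 + ε / 2`, where `γ = ε / (2 * p)`
    -- and `ρ - a = ε / 2`.
    have h3 : (2 * (p / ε) + 4 * (p * (p + 1) / ε ^ 2)) * (ε / (2 * p) * (ε / 2)) =
        ε / 2 + (p + 1) := by
      field_simp
      ring
    rw [h3] at h2
    rw [add_sub_cancel_left]
    linarith
  · obtain ⟨κ, h1, h2, h3⟩ := h j
    rw [add_sub_cancel_left] at h2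
    exact ⟨κ, h2, h3.trans (hb _ _ h1)⟩

theorem passesSuffice_weighted (hp : 1 ≤ p) {ε : ℝ} (hε : 0 < ε) :
    PassesSuffice (fun v κ => (1 + ε / (2 * p)) * (p * v + (p - 1) * κ)) (1 + ε / (2 * p))
      (numPasses p ε) (p + ε) := by
  have hp0 : (0 : ℝ) < p := by exact_mod_cast hp
  have h1 : (1 + ε / (2 * p)) * p = p + ε / 2 := by field_simp
  have h2 := passesSuffice_of_le (a := p + ε / 2) (b := fun v κ => (1 + ε / (2 * p)) *
    (p * v + (p - 1) * κ)) hp hε (by positivity) (by linarith) fun v κ hκ => by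
      have h3 : 0 ≤ (1 + ε / (2 * p)) * κ := by positivity
      rw [← h1]
      nlinarith
  rwa [add_assoc, add_halves] at h2

theorem passesSuffice_submodular (hp : 1 ≤ p) {ε : ℝ} (hε : 0 < ε) :
    PassesSuffice (fun v κ => v + κ + (1 + ε / (2 * p)) * (p * v + (p - 1) * κ))
      (1 + ε / (2 * p)) (numPasses p ε) (p + 1 + ε) := by
  have hp0 : (0 : ℝ) < p := by exact_mod_cast hp
  have h1 : (1 + ε / (2 * p)) * p = p + ε / 2 := by field_simp
  have h2 := passesSuffice_of_le (a := p + 1 + ε / 2) (b := fun v κ => v + κ +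
    (1 + ε / (2 * p)) * (p * v + (p - 1) * κ)) hp hε (by positivity) (by linarith) fun v κ hκ => by
      have h3 : 0 ≤ (1 + ε / (2 * p)) * κ := by positivity
      have h4 : p + 1 + ε / 2 = 1 + (1 + ε / (2 * p)) * p := by rw [h1]; ring
      rw [h4]
      nlinarith
  rwa [add_assoc, add_halves] at h2

end passes

/-! ## Hypermatchings -/

section hypermatching

variable {V : Type}

/-- The closure operator of the matroid in which the sets with at most one edge at `v` are
independent. -/
def vertexClosure (v : V) : ClosureOperator (Set (Finset V)) :=
  ClosureOperator.mk₂ (fun T => T ∪ {x | v ∈ x ∧ ∃ t ∈ T, v ∈ t})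
    (fun _ => Set.subset_union_left) (by
      rintro S T h x (hx | ⟨hx, t, ht, hvt⟩)
      · exact h hx
      · rcases h ht with ht' | ⟨-, u, hu, hvu⟩
        · exact Or.inr ⟨hx, t, ht', hvt⟩
        · exact Or.inr ⟨hx, u, hu, hvu⟩)

theorem mem_vertexClosure {v : V} {T : Set (Finset V)} {x : Finset V} :
    x ∈ vertexClosure v T ↔ x ∈ T ∨ v ∈ x ∧ ∃ t ∈ T, v ∈ t := Iff.rfl

/-- The closure system for matchings of edges of size at most `p`. -/
def hyperSystem (V : Type) {p : ℕ} (hp : 1 ≤ p) :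
    ClosureSystem (Finset V) (Option V) p where
  -- The dummy index `none`, with the identity as closure, serves the empty edge, which has no
  -- vertex but needs an index, and the edges that are too large.
  N e := if e.Nonempty ∧ #e ≤ p then e.map .some else {none}
  cl i := i.elim (ClosureOperator.id _) vertexClosure
  one_le_card e := by
    split_ifs with h
    · rw [card_map]; exact h.1.card_pos
    · rw [card_singleton]
  card_le e := by
    split_ifs with h
    · rw [card_map]; exact h.2
    · rwa [card_singleton]

theorem some_mem_hyperSystem_N {p : ℕ} {hp : 1 ≤ p} {v : V} {e : Finset V} :
    some v ∈ (hyperSystem V hp).N e ↔ v ∈ e ∧ #e ≤ p := by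
  unfold hyperSystem
  dsimp only
  split_ifs with h
  · simp [h.2]
  · simp only [mem_singleton, reduceCtorEq, false_iff, not_and]
    exact fun hv hc => h ⟨⟨v, hv⟩, hc⟩

variable [DecidableEq V]

/-- The conflict set of an edge `e` consists of the edges that meet `e`. -/
def hyperConflict (e : Finset V) (L : List (Finset V)) : Option (Finset (Finset V)) :=
  some {x ∈ L.toFinset | ¬ Disjoint x e}

theorem hyperSystem_isRule {p : ℕ} (hp : 1 ≤ p) {E : Finset (Finset V)} (hE : ∀ e ∈ E, #e ≤ p) :
    (hyperSystem V hp).IsRule E IsHypermatching fun L e _ => hyperConflict e L where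
  indep J _ hJ i A B hA hN hAB := by
    cases i with
    | none => exact card_le_card (coe_subset.1 hAB)
    | some v =>
      have hv : ∀ o ∈ A, v ∈ o := fun o ho => (some_mem_hyperSystem_N.1 (hN o ho)).1
      obtain rfl | ⟨o, ho⟩ := A.eq_empty_or_nonempty
      · simp
      · have h1 : #A ≤ 1 := card_le_one.2 fun a ha b hb => by
          by_contra hne
          exact disjoint_left.1 (hJ (hA ha) (hA hb) hne) (hv a ha) (hv b hb)
        refine h1.trans (card_pos.2 ?_)
        rcases mem_vertexClosure.1 (hAB ho) with h | ⟨-, t, ht, -⟩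
        · exact ⟨o, h⟩
        · exact ⟨t, ht⟩
  none _ _ _ _ _ _ h := by simp [hyperConflict] at h
  some L e w C hL he heL hC := by
    obtain rfl : {x ∈ L.toFinset | ¬ Disjoint x e} = C := by simpa [hyperConflict] using hC
    constructor
    -- The solution has at most one edge at each vertex, so `T (some v)` is empty or a singleton,
    -- and minimality of the weight is automatic.
    · let T : Option V → Finset (Finset V) := fun i =>
        L.toFinset.filter fun x => ∃ v ∈ x, i = some v
      let x : Option V → Finset V := fun i => if h : (T i).Nonempty then h.choose else ∅
      have hx : ∀ i y, y ∈ T i → x i = y := by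
        intro i y hy
        have h : (T i).Nonempty := ⟨y, hy⟩
        have hxT : x i ∈ T i := by
          simp only [x, dif_pos h]
          exact h.choose_spec
        obtain ⟨hy1, v, hv, rfl⟩ := mem_filter.1 hy
        obtain ⟨hx1, u, hu, huv⟩ := mem_filter.1 hxT
        obtain rfl : v = u := Option.some.inj huv
        by_contra hne
        exact disjoint_left.1 (hL.indep hx1 hy1 hne) hu hv
      refine ⟨{i ∈ (hyperSystem V hp).N e | (T i).Nonempty}, T, x, filter_subset _ _, ?_, ?_⟩
      · ext y
        simp only [mem_filter, mem_image]
        constructor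
        · rintro ⟨hy, hdis⟩
          obtain ⟨v, hvy, hve⟩ := not_disjoint_iff.1 hdis
          have hyT : y ∈ T (some v) := mem_filter.2 ⟨hy, v, hvy, rfl⟩
          exact ⟨some v, ⟨some_mem_hyperSystem_N.2 ⟨hve, hE e he⟩, ⟨y, hyT⟩⟩, hx _ _ hyT⟩
        · rintro ⟨i, ⟨hi, z, hz⟩, rfl⟩
          rw [hx i z hz]
          obtain ⟨hz1, v, hv, rfl⟩ := mem_filter.1 hz
          exact ⟨hz1, not_disjoint_iff.2 ⟨v, hv, (some_mem_hyperSystem_N.1 hi).1⟩⟩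
      · intro i hi
        obtain ⟨hiN, z, hz⟩ := mem_filter.1 hi
        obtain rfl := hx i z hz
        obtain ⟨hz1, v, hv, rfl⟩ := mem_filter.1 hz
        have hve := (some_mem_hyperSystem_N.1 hiN).1
        refine ⟨filter_subset _ _, hz, fun y hy => ?_, ?_, ?_⟩
        · rw [← hx _ y hy]
          exact ⟨le_rfl, some_mem_hyperSystem_N.2 ⟨hv, hE _ (hL.subset hz1)⟩⟩
        · exact mem_vertexClosure.2 (Or.inr ⟨hve, _, hz, hv⟩)
        · exact mem_vertexClosure.2 (Or.inr ⟨hv, e, Set.mem_insert _ _, hve⟩)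
    · intro a ha b hb hab
      simp only [coe_insert, coe_sdiff, Set.mem_insert_iff, Set.mem_sdiff, mem_coe,
        mem_filter, not_and, not_not] at ha hb
      rcases ha with rfl | ha
      · rcases hb with rfl | hb
        · exact absurd rfl hab
        · exact (hb.2 hb.1).symm
      · rcases hb with rfl | hb
        · exact ha.2 ha.1
        · exact hL.indep ha.1 hb.1 hab

theorem IsHypermatching.sum_card_le [Fintype V] {M : Finset (Finset V)} (h : IsHypermatching M) :
    ∑ e ∈ M, #e ≤ Fintype.card V := by
  rw [← card_biUnion h]
  exact card_le_univ _

/-- Each nonempty edge uses up a vertex; the extra `1` accounts for the empty edge. -/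
theorem IsHypermatching.card_le [Fintype V] {M : Finset (Finset V)} (h : IsHypermatching M) :
    #M ≤ Fintype.card V + 1 := by
  have h1 : #(M.erase ∅) ≤ ∑ e ∈ M, #e := by
    rw [card_eq_sum_ones]
    refine (sum_le_sum fun e he => ?_).trans (sum_le_sum_of_subset (erase_subset _ _))
    exact (nonempty_iff_ne_empty.2 (ne_of_mem_erase he)).card_pos
  have h2 := pred_card_le_card_erase (s := M) (a := ∅)
  have h3 := h.sum_card_le
  omega

theorem hypermatching_fitsIn {p n : ℕ} {E : Finset (Finset (Fin n))} {σ L : List (Finset (Fin n))}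
    (hσ : ∀ e ∈ σ, #e ≤ p) (hL : IsSolution E IsHypermatching L) :
    FitsIn (fun (_ : Fin 0) (_ : Finset (Finset (Fin n))) => ∅) (hyperedgeCost n)
      ((3 * p + 20) * (n + 1) * Nat.size (n + 1)) L σ := by
  have h1 := hL.indep.sum_card_le
  have h2 := hL.indep.card_le
  rw [Fintype.card_fin] at h1 h2
  rw [List.toFinset_card_of_nodup hL.nodup] at h2
  have hsum : (L.map (hyperedgeCost n · + 1)).sum ≤ n * Nat.size n + 2 * L.length := by
    have h3 : (L.map (hyperedgeCost n · + 1)).sum =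
        (∑ e ∈ L.toFinset, #e) * Nat.size n + 2 * L.length := by
      rw [List.sum_toFinset _ hL.nodup]
      clear h1 h2 hL
      induction L with
      | nil => simp
      | cons a L ih =>
        rw [List.map_cons, List.sum_cons, List.map_cons, List.sum_cons, ih, List.length_cons,
          hyperedgeCost]
        ring
    rw [h3]
    exact Nat.add_le_add_right (Nat.mul_le_mul_right _ h1) _
  have hz : Nat.size n ≤ Nat.size (n + 1) := Nat.size_le_size (Nat.le_succ n)
  have hZ : 1 ≤ Nat.size (n + 1) := Nat.size_pos.2 (Nat.succ_pos n)
  set Y := (n + 1) * Nat.size (n + 1) with hY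
  have hY1 : n + 1 ≤ Y := Nat.le_mul_of_pos_right _ hZ
  have hY2 : Nat.size (n + 1) ≤ Y := Nat.le_mul_of_pos_left _ (Nat.succ_pos n)
  have hY3 : n * Nat.size n ≤ Y := Nat.mul_le_mul (Nat.le_succ n) hz
  rw [mul_assoc, ← hY]
  constructor
  · nlinarith
  · intro e he
    rw [List.map_cons, List.sum_cons, Finset.univ_eq_empty, sum_empty, hyperedgeCost]
    have h4 : #e * Nat.size n ≤ p * Y := Nat.mul_le_mul (hσ e he) (hz.trans hY2)
    nlinarith

end hypermatching

/-! ## Intersections of matroids -/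

section matroids

variable {m p : ℕ}

/-- The closure operator of a matroid on all elements of a type. -/
def matroidClosure {α : Type} (M : Matroid α) (hM : M.E = Set.univ) : ClosureOperator (Set α) :=
  ClosureOperator.mk' M.closure (fun _ _ h => M.closure_subset_closure h)
    (fun X => M.subset_closure X (hM ▸ Set.subset_univ X)) fun X => (M.closure_closure X).le

/-- The closure system of a family of matroids. -/
def matroidSystem (M : Fin p → Matroid (Fin m)) (hM : ∀ i, (M i).E = Set.univ) (hp : 1 ≤ p) :
    ClosureSystem (Fin m) (Fin p) p where
  N _ := univ
  cl i := matroidClosure (M i) (hM i)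
  one_le_card _ := by simpa using hp
  card_le _ := by simp

/-- An element of `T` of minimum weight, or `e` if `T` is empty. -/
noncomputable def argminOr {α : Type} (w : α → ℝ) (T : Finset α) (e : α) : α :=
  open Classical in
  if h : T.Nonempty then (exists_min_image T w h).choose else e

theorem argminOr_spec {α : Type} (w : α → ℝ) {T : Finset α} (e : α) (h : T.Nonempty) :
    argminOr w T e ∈ T ∧ ∀ y ∈ T, w (argminOr w T e) ≤ w y := by
  rw [argminOr, dif_pos h]
  exact (exists_min_image T w h).choose_spec

/-- The conflict set of `e` consists of one element of minimum weight from each circuit; there is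
none if `e` is a loop. -/
noncomputable def matroidConflict (ans : Fin p → Finset (Fin m)) (e : Fin m) (w : Fin m → ℝ) :
    Option (Finset (Fin m)) :=
  open Classical in
  if ∃ i, ans i = {e} then none
  else some (({i | (ans i).Nonempty} : Finset (Fin p)).image
    fun i => argminOr w ((ans i).erase e) e)

/-- As the solution is independent, the circuit answered for it together with `e` is the fundamental
circuit of `e`, so any other element of it may be exchanged for `e`. -/
theorem matroidSystem_isRule (M : Fin p → Matroid (Fin m)) (hM : ∀ i, (M i).E = Set.univ)
    (hp : 1 ≤ p) {orc : Fin p → Finset (Fin m) → Finset (Fin m)}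
    (horc : ∀ i, IsCircuitOracle (M i) (orc i)) (E : Finset (Fin m)) :
    (matroidSystem M hM hp).IsRule E (CommonIndep M) fun L e w =>
      matroidConflict (fun i => orc i (e :: L).toFinset) e w where
  indep J _ hJ i A B hA _ hAB := by
    have h1 : (A : Set (Fin m)).encard ≤ (M i).eRk ((M i).closure B) :=
      ((hJ i).subset (coe_subset.2 hA)).encard_le_eRk_of_subset hAB
    rw [Matroid.eRk_closure_eq] at h1
    have h2 := h1.trans ((M i).eRk_le_encard B)
    rw [Set.encard_coe_eq_coe_finsetCard, Set.encard_coe_eq_coe_finsetCard] at h2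
    exact_mod_cast h2
  none L e w _ _ _ h J hJ heJ := by
    unfold matroidConflict at h
    split_ifs at h with hloop
    obtain ⟨i, hi⟩ := hloop
    dsimp only at hi
    have hdep : ¬ (M i).Indep ((e :: L).toFinset : Set (Fin m)) := fun hind => by
      rw [(horc i _).1 hind] at hi
      exact (singleton_ne_empty e) hi.symm
    have hcirc := ((horc i _).2 hdep).2
    rw [hi] at hcirc
    refine hcirc.not_indep ((hJ i).subset ?_)
    simpa using heJ
  some L e w C hL _ heL hC := by
    unfold matroidConflict at hC
    split_ifs at hC with hloop
    rw [Option.some.injEq] at hC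
    set ans := fun i => orc i (e :: L).toFinset with hans
    have hcirc : ∀ i, (ans i).Nonempty → ans i ⊆ insert e L.toFinset ∧
        (M i).IsCircuit (ans i) ∧ e ∈ ans i ∧ ((ans i).erase e).Nonempty := by
      intro i hi
      have hdep : ¬ (M i).Indep ((e :: L).toFinset : Set (Fin m)) := fun hind =>
        hi.ne_empty ((horc i _).1 hind)
      obtain ⟨h1, h2⟩ := (horc i _).2 hdep
      rw [List.toFinset_cons] at h1
      have he : e ∈ ans i := by
        by_contra he
        refine h2.not_indep ((hL.indep i).subset ?_)
        exact coe_subset.2 ((subset_insert_iff_of_notMem he).1 (by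
          simpa [hans] using h1))
      refine ⟨by simpa [hans] using h1, h2, he, ?_⟩
      rw [nonempty_iff_ne_empty, Ne, erase_eq_empty_iff]
      exact not_or.2 ⟨hi.ne_empty, fun h => hloop ⟨i, h⟩⟩
    have hmin : ∀ i, (ans i).Nonempty → _ := fun i hi =>
      argminOr_spec w e (hcirc i hi).2.2.2
    constructor
    · refine ⟨_, fun i => (ans i).erase e, _, subset_univ _, hC.symm, fun i hi => ?_⟩
      have hi' : (ans i).Nonempty := by simpa using hi
      obtain ⟨h1, h2, h3, h4⟩ := hcirc i hi'
      obtain ⟨h5, h6⟩ := hmin i hi'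
      refine ⟨fun y hy => ?_, h5, fun y hy => ⟨h6 y hy, mem_univ _⟩, ?_, ?_⟩
      · exact (mem_insert.1 (h1 (mem_of_mem_erase hy))).resolve_left (ne_of_mem_erase hy)
      · have := h2.mem_closure_sdiff_singleton_of_mem h3
        rw [coe_erase]
        exact this
      · refine (M i).closure_subset_closure ?_
          (h2.mem_closure_sdiff_singleton_of_mem (mem_of_mem_erase h5))
        rintro y ⟨hy, hyx⟩
        by_cases hye : y = e
        · exact Or.inl hye
        · exact Or.inr ⟨mem_coe.2 (mem_erase.2 ⟨hye, hy⟩), hyx⟩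
    · intro i
      by_cases hi : (ans i).Nonempty
      · obtain ⟨h1, h2, h3, h4⟩ := hcirc i hi
        obtain ⟨h5, -⟩ := hmin i hi
        have hxC : argminOr w ((ans i).erase e) e ∈ C := by
          rw [← hC]
          exact mem_image.2 ⟨i, by simpa using hi, rfl⟩
        by_contra hdep
        -- A circuit surviving the exchange would be the same fundamental circuit, but one of its
        -- elements was removed with `C`.
        obtain ⟨C', hC'sub, hC'⟩ := ((M i).not_indep_iff (by rw [hM i]; exact Set.subset_univ _)).1
          hdep |>.exists_isCircuit_subset
        have h7 := hC'.eq_fundCircuit_of_subset (hL.indep i) (e := e) (hC'sub.trans (by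
          rw [coe_insert, coe_sdiff]
          exact Set.insert_subset_insert Set.sdiff_subset))
        have h8 := h2.eq_fundCircuit_of_subset (hL.indep i) (e := e) (by
          rw [← coe_insert]
          exact coe_subset.2 h1)
        rw [← h8] at h7
        have h9 := hC'sub (h7 ▸ mem_coe.2 (mem_of_mem_erase h5))
        rw [mem_coe, mem_insert, mem_sdiff] at h9
        exact h9.elim (ne_of_mem_erase h5) fun h => h.2 hxC
      · have hind : (M i).Indep ((e :: L).toFinset : Set (Fin m)) := by
          by_contra hdep
          obtain ⟨h1, h2⟩ := (horc i _).2 hdep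
          exact hi (coe_nonempty.1 h2.nonempty)
        refine hind.subset (coe_subset.2 ?_)
        rw [List.toFinset_cons]
        exact insert_subset_insert _ sdiff_subset

theorem card_le_commonRank (M : Fin p → Matroid (Fin m)) {I : Finset (Fin m)}
    (h : CommonIndep M I) : #I ≤ commonRank M := by
  refine le_csSup ⟨m, ?_⟩ ⟨I, h, rfl⟩
  rintro r ⟨J, -, rfl⟩
  simpa using card_le_univ J

theorem matroid_fitsIn (M : Fin p → Matroid (Fin m))
    {orc : Fin p → Finset (Fin m) → Finset (Fin m)} (horc : ∀ i, IsCircuitOracle (M i) (orc i))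
    {E : Finset (Fin m)} {σ L : List (Fin m)} (hL : IsSolution E (CommonIndep M) L) :
    FitsIn orc (fun _ => Nat.size m)
      ((3 * p + 20) * (commonRank M + 1) * Nat.size (m + 1)) L σ := by
  have hlen := card_le_commonRank M hL.indep
  rw [List.toFinset_card_of_nodup hL.nodup] at hlen
  set n := commonRank M
  have hz : Nat.size m ≤ Nat.size (m + 1) := Nat.size_le_size (Nat.le_succ m)
  have hZ : 1 ≤ Nat.size (m + 1) := Nat.size_pos.2 (Nat.succ_pos m)
  set Y := (n + 1) * Nat.size (m + 1) with hY
  have hY1 : n + 1 ≤ Y := Nat.le_mul_of_pos_right _ hZ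
  have hY2 : Nat.size (m + 1) ≤ Y := Nat.le_mul_of_pos_left _ (Nat.succ_pos n)
  have hlist : ∀ L : List (Fin m), (L.map fun _ => Nat.size m + 1).sum =
      L.length * (Nat.size m + 1) := fun L => by simp
  have hLY : (L.length + 1) * Nat.size m ≤ Y := Nat.mul_le_mul (Nat.succ_le_succ hlen) hz
  rw [mul_assoc, ← hY]
  constructor
  · rw [hlist]
    nlinarith
  · intro e _
    rw [hlist, List.length_cons]
    have hans : ∀ i ∈ (univ : Finset (Fin p)), Nat.size #(orc i (e :: L).toFinset) + 1 +
        ∑ a ∈ orc i (e :: L).toFinset, Nat.size m ≤ 3 * Y := by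
      intro i _
      have hsub : orc i (e :: L).toFinset ⊆ (e :: L).toFinset := by
        by_cases h : (M i).Indep ((e :: L).toFinset : Set (Fin m))
        · rw [(horc i _).1 h]; exact empty_subset _
        · exact ((horc i _).2 h).1
      have h1 : #(orc i (e :: L).toFinset) ≤ L.length + 1 :=
        (card_le_card hsub).trans (List.toFinset_card_le _)
      have h2 : Nat.size #(orc i (e :: L).toFinset) ≤ Nat.size m :=
        Nat.size_le_size (by simpa using card_le_univ (orc i (e :: L).toFinset))
      have h3 := Nat.mul_le_mul_right (Nat.size m) h1
      rw [sum_const, smul_eq_mul]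
      omega
    have h4 := sum_le_sum hans
    rw [sum_const, card_univ, Fintype.card_fin, smul_eq_mul] at h4
    nlinarith

end matroids

/-! ## The algorithms for hypermatchings and for intersections of matroids -/

theorem exists_hypergraphMWIS {p k : ℕ} (hp : 1 ≤ p) {r ρ : ℝ} (hr : 1 ≤ r)
    (hb : PassesSuffice (fun v κ => r * (p * v + (p - 1) * κ)) r k ρ) :
    ∃ A, HypergraphMWIS p k (3 * p + 20) ρ A := by
  refine ⟨fun n => weightedSearch r fun _ e L _ => hyperConflict e L, fun n σ hσ w hw => ?_⟩
  exact weightedSearch_solves hw hr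
    (hyperSystem_isRule hp fun e he => hσ.2 e (List.mem_toFinset.1 he))
    (by simp [IsHypermatching]) (fun L hL => hypermatching_fitsIn hσ.2 hL) hb

theorem exists_hypergraphMSIS {p k : ℕ} (hp : 1 ≤ p) {r ρ : ℝ} (hr : 1 ≤ r)
    (hb : PassesSuffice (fun v κ => v + κ + r * (p * v + (p - 1) * κ)) r k ρ) :
    ∃ A, HypergraphMSIS p k (3 * p + 20) ρ A := by
  refine ⟨fun n => submodularSearch r fun _ e L _ => hyperConflict e L, fun n σ hσ f hf => ?_⟩
  exact submodularSearch_solves hf hr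
    (hyperSystem_isRule hp fun e he => hσ.2 e (List.mem_toFinset.1 he))
    (by simp [IsHypermatching]) (fun L hL => hypermatching_fitsIn hσ.2 hL) hb

theorem exists_matroidMWIS (P : ∀ m : ℕ, Matroid (Fin m) → Prop) {p k : ℕ} (hp : 1 ≤ p) {r ρ : ℝ}
    (hr : 1 ≤ r) (hb : PassesSuffice (fun v κ => r * (p * v + (p - 1) * κ)) r k ρ) :
    ∃ A, MatroidMWIS P p k (3 * p + 20) ρ A := by
  refine ⟨fun m => weightedSearch r fun ans e _ w => matroidConflict ans e w,
    fun m M hM _ orc horc σ _ _ w hw => ?_⟩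
  exact weightedSearch_solves (fun e _ => hw e) hr (matroidSystem_isRule M hM hp horc _)
    (fun i => by simp) (fun L hL => matroid_fitsIn M horc hL) hb

theorem exists_matroidMSIS (P : ∀ m : ℕ, Matroid (Fin m) → Prop) {p k : ℕ} (hp : 1 ≤ p) {r ρ : ℝ}
    (hr : 1 ≤ r) (hb : PassesSuffice (fun v κ => v + κ + r * (p * v + (p - 1) * κ)) r k ρ) :
    ∃ A, MatroidMSIS P p k (3 * p + 20) ρ A := by
  refine ⟨fun m => submodularSearch r fun ans e _ w => matroidConflict ans e w,
    fun m M hM _ orc horc σ _ hσ f hf => ?_⟩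
  have hσ' : σ.toFinset = univ := eq_univ_iff_forall.2 fun e => List.mem_toFinset.2 (hσ e)
  exact submodularSearch_solves (hσ' ▸ hf) hr (matroidSystem_isRule M hM hp horc _)
    (fun i => by simp) (fun L hL => matroid_fitsIn M horc hL) hb

theorem theorem3 :
    ∃ K : ℝ, ∀ p : ℕ, 1 ≤ p → ∃ C : ℕ,
      ((∃ A, HypergraphMWIS p 1 C (2 * (p + √((p : ℝ) * (p - 1))) - 1) A) ∧
        (∃ A, MatroidMWIS (fun _ _ => True) p 1 C (2 * (p + √((p : ℝ) * (p - 1))) - 1) A) ∧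
        (∃ A, HypergraphMSIS p 1 C (4 * p) A) ∧
        (∃ A, MatroidMSIS (fun _ _ => True) p 1 C (4 * p) A)) ∧
      ∀ ε : ℝ, 0 < ε →
        ∃ k : ℕ, (k : ℝ) ≤ 1 + K * ((p : ℝ) ^ 4 * (ε⁻¹ ^ 3 * Real.log (p + 1))) ∧
          (∃ A, HypergraphMWIS p k C (p + ε) A) ∧
          (∃ A, MatroidMWIS (fun _ M => IsPartitionMatroid M) p k C (p + ε) A) ∧
          (∃ A, HypergraphMSIS p k C (p + 1 + ε) A) ∧
          (∃ A, MatroidMSIS (fun _ M => IsPartitionMatroid M) p k C (p + 1 + ε) A) := by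
  refine ⟨128, fun p hp => ⟨3 * p + 20, ?_, fun ε hε => ⟨numPasses p ε, numPasses_le hp hε, ?_⟩⟩⟩
  · have hr : 1 ≤ 1 + √((p : ℝ) * (p - 1)) / p := le_add_of_nonneg_right (by positivity)
    have hw := passesSuffice_weighted_one hp
    have hf := passesSuffice_submodular_one hp
    exact ⟨exists_hypergraphMWIS hp hr hw, exists_matroidMWIS _ hp hr hw,
      exists_hypergraphMSIS hp one_le_two hf, exists_matroidMSIS _ hp one_le_two hf⟩
  · have hr : 1 ≤ 1 + ε / (2 * p) := le_add_of_nonneg_right (by positivity)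
    have hw := passesSuffice_weighted hp hε
    have hf := passesSuffice_submodular hp hε
    exact ⟨exists_hypergraphMWIS hp hr hw, exists_matroidMWIS _ hp hr hw,
      exists_hypergraphMSIS hp hr hf, exists_matroidMSIS _ hp hr hf⟩
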